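/- Let $n,m,D\ge 0$ be integers, let $A\in\mathbb R^{n\times n}$ be invertible, and let $B_\tau,C_\tau\in\mathbb R^{n\times m}$ and $\sigma_\tau\in\mathbb R$ for $0\le\tau\le D$. On a probability space let $\omega_t=(\omega_t^0,\dots,\omega_t^D)'$, $t\ge 0$, be independent square-integrable random vectors with $\mathbf E(\omega_t^\tau)=0$ and $\mathbf E(\omega_t^i\omega_t^j)=\sigma_i^2\delta_{ij}$. Let $\mathcal F_{t}=\sigma(\omega_s:0\le s\le t)$, with $\mathcal F_{-1}$ trivial. Consider the multi-delay system $$x_{t+1}=Ax_t+\sum_{\tau=0}^D\left(B_\tau+\omega_t^\tau C_\tau\right)u_{t-\tau},\qquad t\ge 0,\tag{1}$$ with deterministic initial values $x_0\in\mathbb R^n$ and $u_{-D},\dots,u_{-1}\in\mathbb R^m$. A feedback law $u_t=K_0x_t+\sum_{\tau=1}^DK_\tau u_{t-\tau}$ ($t\ge0$) with constant matrices $K_0,\dots,K_D$ is called an admissible stabilizing control if, for all initial values, the resulting closed-loop trajectory satisfies: $u_t$ is $\mathcal F_{t-1}$-measurable for every $t\ge0$, $\sum_{t=0}^\infty\mathbf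 E(u_t'u_t)<\infty$, and $\lim_{t\to\infty}\mathbf E(x_t'x_t)=0$. System (1) is called asymptotically mean-square stabilizable if an admissible stabilizing control exists. For symmetric matrices write $M>0$ for "positive definite". Then system (1) is asymptotically mean-square stabilizable if and only if, for all $Q>0$ (of size $n\times n$) and $R>0$ (of size $m\times m$), there is exactly one $Z>0$ that satisfies the delay-dependent algebraic Riccati equation $$-Z+A'ZA+Q-A'ZL\Psi^{-1}L'ZA=0,\tag{2}$$ where $$L=\sum_{j=0}^DA^{D-j}B_j,\qquad \Psi=L'ZL+\sum_{\tau=0}^D\sigma_\tau^2C_\tau'(A')^DZA^DC_\tau+U_{R,Q},$$ $$U_{R,Q}=R+\sum_{\tau=1}^D\sum_{h=1}^\tau\sigma_\tau^2C_\tau'(A')^{D-h}QA^{D-h}C_\tau .$$ Moreover, whenever $Q>0$, $R>0$ and $Z>0$ satisfy (2), the feedback law $$u_t^*=-\Psi^{-1}L'ZA^D\Big(Ax_t+\sum_{\tau=1}^D\sum_{j=\tau}^DA^{\tau-j}B_ju^*_{t-\tau}\Big)$$ is an admissible stabilizing control for system (1). -/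

import Mathlib

open MeasureTheory ProbabilityTheory Filter Topology
open scoped Matrix

noncomputable section

/-- The data of the multi-delay system
`x_{t+1} = A x_t + ∑_{τ=0}^D (B_τ + ω_t^τ C_τ) u_{t-τ}`, where the channel `τ` carries a noise
of variance `σ_τ ^ 2`. -/
structure MultiDelaySystem (n m D : ℕ) where
  A : Matrix (Fin n) (Fin n) ℝ
  B : Fin (D + 1) → Matrix (Fin n) (Fin m) ℝ
  C : Fin (D + 1) → Matrix (Fin n) (Fin m) ℝ
  σ : Fin (D + 1) → ℝ

/-- A feedback law computes `u_t` from the current state `x_t` and the last `D` inputs; the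
second argument `p` is the tuple of past inputs, `p i = u_{t-(i+1)}` for `i = 0, …, D - 1`. -/
abbrev FeedbackLaw (n m D : ℕ) : Type :=
  (Fin n → ℝ) → (Fin D → Fin m → ℝ) → (Fin m → ℝ)

/-- The linear law `u_t = K_0 x_t + ∑_{τ=1}^D K_τ u_{t-τ}`; `K i` is the gain `K_{i+1}`. -/
def linearLaw {n m D : ℕ} (K₀ : Matrix (Fin m) (Fin n) ℝ)
    (K : Fin D → Matrix (Fin m) (Fin m) ℝ) : FeedbackLaw n m D :=
  fun x p => K₀ *ᵥ x + ∑ i : Fin D, K i *ᵥ p i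

/-- The σ-algebra `ℱ_{t-1} = σ(ω_s : 0 ≤ s ≤ t - 1)`, which is trivial for `t = 0`. -/
abbrev noisePast {Ω : Type*} {D : ℕ} (ω : ℕ → Ω → Fin (D + 1) → ℝ) (t : ℕ) : MeasurableSpace Ω :=
  ⨆ (s : ℕ) (_ : s < t), MeasurableSpace.comap (ω s) inferInstance

/-- `ω_t = (ω_t^0, …, ω_t^D)`, `t ≥ 0`, are independent square-integrable random vectors, with
mean zero and covariance matrix `diag (σ_0 ^ 2, …, σ_D ^ 2)`. -/
structure IsMultiplicativeNoise {Ω : Type*} [MeasurableSpace Ω] (μ : Measure Ω) {D : ℕ}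
    (σ : Fin (D + 1) → ℝ) (ω : ℕ → Ω → Fin (D + 1) → ℝ) : Prop where
  measurable : ∀ t, Measurable (ω t)
  indep : iIndepFun ω μ
  memLp : ∀ t τ, MemLp (fun w => ω t w τ) 2 μ
  mean : ∀ t τ, ∫ w, ω t w τ ∂μ = 0
  cov : ∀ t i j, ∫ w, ω t w i * ω t w j ∂μ = if i = j then σ i ^ 2 else 0

namespace MultiDelaySystem

variable {n m D : ℕ} (S : MultiDelaySystem n m D)

/-- `(x, u)` is the closed-loop trajectory of the system driven by the noise `ω` under the
feedback law `law`, with the deterministic initial values `x_0 = x₀` and `u_{-(i+1)} = ψ i` for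
`0 ≤ i < D`. -/
structure IsClosedLoop {Ω : Type*} (ω : ℕ → Ω → Fin (D + 1) → ℝ) (law : FeedbackLaw n m D)
    (x₀ : Fin n → ℝ) (ψ : Fin D → Fin m → ℝ)
    (x : ℕ → Ω → Fin n → ℝ) (u : ℤ → Ω → Fin m → ℝ) : Prop where
  init_state : ∀ w, x 0 w = x₀
  init_input : ∀ (i : Fin D) w, u (-((i : ℤ) + 1)) w = ψ i
  dynamics : ∀ (t : ℕ) w, x (t + 1) w =
    S.A *ᵥ x t w + ∑ τ : Fin (D + 1), (S.B τ + ω t w τ • S.C τ) *ᵥ u ((t : ℤ) - (τ : ℤ)) w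
  feedback : ∀ (t : ℕ) w, u (t : ℤ) w = law (x t w) (fun i => u ((t : ℤ) - ((i : ℤ) + 1)) w)

/-- The law `law` is an admissible stabilizing control: it is linear with constant gains and, for
all initial values, the input `u` of the closed loop satisfies
`u_t` is `ℱ_{t-1}`-measurable and `∑_{t ≥ 0} E (u_t' u_t) < ∞`, while `E (x_t' x_t) → 0`.
(The closed-loop trajectory is determined by the initial values for all times that matter.) -/
def IsStabilizedBy {Ω : Type*} [MeasurableSpace Ω] (μ : Measure Ω)
    (ω : ℕ → Ω → Fin (D + 1) → ℝ) (law : FeedbackLaw n m D) : Prop :=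
  (∃ (K₀ : Matrix (Fin m) (Fin n) ℝ) (K : Fin D → Matrix (Fin m) (Fin m) ℝ),
      law = linearLaw K₀ K) ∧
  ∀ (x₀ : Fin n → ℝ) (ψ : Fin D → Fin m → ℝ),
    ∃ (x : ℕ → Ω → Fin n → ℝ) (u : ℤ → Ω → Fin m → ℝ),
      S.IsClosedLoop ω law x₀ ψ x u ∧
      (∀ t : ℕ, Measurable[noisePast ω t] (u (t : ℤ))) ∧
      (∀ t : ℕ, Integrable (fun w => u (t : ℤ) w ⬝ᵥ u (t : ℤ) w) μ) ∧
      Summable (fun t : ℕ => ∫ w, u (t : ℤ) w ⬝ᵥ u (t : ℤ) w ∂μ) ∧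
      (∀ t : ℕ, Integrable (fun w => x t w ⬝ᵥ x t w) μ) ∧
      Tendsto (fun t : ℕ => ∫ w, x t w ⬝ᵥ x t w ∂μ) atTop (𝓝 0)

/-- Asymptotic mean-square stabilizability by admissible controls. -/
def IsStabilizable {Ω : Type*} [MeasurableSpace Ω] (μ : Measure Ω)
    (ω : ℕ → Ω → Fin (D + 1) → ℝ) : Prop :=
  ∃ law : FeedbackLaw n m D, S.IsStabilizedBy μ ω law

/-- `L = ∑_{j=0}^D A^{D-j} B_j`. -/
def L : Matrix (Fin n) (Fin m) ℝ :=
  ∑ j : Fin (D + 1), S.A ^ (D - (j : ℕ)) * S.B j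

/-- `U_{R,Q} = R + ∑_{τ=1}^D ∑_{h=1}^τ σ_τ^2 C_τ' (A')^{D-h} Q A^{D-h} C_τ`
(for `τ = 0` the inner sum is empty). -/
def U (R : Matrix (Fin m) (Fin m) ℝ) (Q : Matrix (Fin n) (Fin n) ℝ) :
    Matrix (Fin m) (Fin m) ℝ :=
  R + ∑ τ : Fin (D + 1), ∑ h ∈ Finset.Icc 1 (τ : ℕ),
    S.σ τ ^ 2 • ((S.C τ)ᵀ * S.Aᵀ ^ (D - h) * Q * S.A ^ (D - h) * S.C τ)

/-- `Ψ = L' Z L + ∑_{τ=0}^D σ_τ^2 C_τ' (A')^D Z A^D C_τ + U_{R,Q}`. -/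
def Ψ (R : Matrix (Fin m) (Fin m) ℝ) (Q Z : Matrix (Fin n) (Fin n) ℝ) :
    Matrix (Fin m) (Fin m) ℝ :=
  S.Lᵀ * Z * S.L
    + ∑ τ : Fin (D + 1), S.σ τ ^ 2 • ((S.C τ)ᵀ * S.Aᵀ ^ D * Z * S.A ^ D * S.C τ)
    + S.U R Q

/-- The delay-dependent algebraic Riccati equation
`-Z + A' Z A + Q - A' Z L Ψ⁻¹ L' Z A = 0`. -/
def DDARE (R : Matrix (Fin m) (Fin m) ℝ) (Q Z : Matrix (Fin n) (Fin n) ℝ) : Prop :=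
  -Z + S.Aᵀ * Z * S.A + Q
    - S.Aᵀ * Z * S.L * (S.Ψ R Q Z)⁻¹ * S.Lᵀ * Z * S.A = 0

/-- The law
`u_t = -Ψ⁻¹ L' Z A^D (A x_t + ∑_{τ=1}^D ∑_{j=τ}^D A^{τ-j} B_j u_{t-τ})`, with `τ = i + 1`;
the powers of `A` have integer exponents. -/
def riccatiLaw (R : Matrix (Fin m) (Fin m) ℝ) (Q Z : Matrix (Fin n) (Fin n) ℝ) :
    FeedbackLaw n m D :=
  fun x p => -(((S.Ψ R Q Z)⁻¹ * S.Lᵀ * Z * S.A ^ D) *ᵥ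
    (S.A *ᵥ x + ∑ i : Fin D, ∑ j ∈ Finset.Ici i.succ,
      (S.A ^ (((i : ℤ) + 1) - (j : ℤ)) * S.B j) *ᵥ p i))

end MultiDelaySystem

end

/-!
Under a linear law, the augmented state `ξ_t = (x_t, (u_{t-1}, …, u_{t-D}))` follows a linear
recursion whose coefficients are perturbed by noise independent of the past. Hence the mean of a
quadratic form `q` of `ξ_t` is `T^t q` at the initial value, for a positive linear operator `T` on
quadratic forms (`momentOperator`, `integral_quadraticForm`), and a law is admissible if and only
if the second moments tend to `0` from every initial value (`isStabilizedBy_linearLaw_iff`): in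
finite dimension such convergence is exponential (`exists_sum_momentOperator_pow_le`). Everything
else is a statement about `T`.

The predictor `y` of the state removes the delay from the deterministic part:
`y_{t+1} = A y_t + L u_t + ∑ τ, ω_t^τ A^D C_τ u_{t-τ}` (`predictor_drift`,
`predictor_diffusion`). The remaining delay in the noise does not matter for second moments: when
`y' Z y` is supplemented by the energy that the past inputs still have to inject, the resulting
storage function `V_Z` changes in the mean as `y' Z y` does for an undelayed system
(`momentOperator_storage`). For that system the Riccati equation is the Bellman equation with stage
cost `W = y' Q y + u' U u` (`stageCost_add_surrogateStep`).

If `Z > 0` solves the Riccati equation, then `T V_Z + W = V_Z` under the predictor feedback, so the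
total cost is finite; this makes `y` and `u` square summable in mean, and the law is stabilizing
(`isMeanSquareStable_riccatiInput`). Conversely, along any stabilizing law the value iteration
`Z_{k+1} = riccatiStep Z_k`, `Z_0 = 0`, satisfies `V_{Z_k} ≤ T V_{Z_k} + W`, because
`Z_k ≤ Z_{k+1}`. Telescoping bounds `Z_k` by the total cost of that law (`riccatiIterate_bounded`),
so the increasing sequence `Z_k` converges to a solution (`exists_posDef_DDARE`). The same
telescoping along the closed loop of one solution compares it with another one, which gives
uniqueness (`dotProduct_le_of_DDARE`).
-/

noncomputable section

/-! ### Quadratic forms on finite-dimensional spaces -/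

section QuadraticForms

variable {E : Type*} [NormedAddCommGroup E] [NormedSpace ℝ E]

theorem QuadraticForm.continuous_of_finiteDimensional [FiniteDimensional ℝ E]
    (q : QuadraticForm ℝ E) : Continuous q := by
  have h : ∀ ξ, q ξ = (QuadraticMap.associated q).toContinuousBilinearMap ξ ξ := fun ξ => by
    rw [LinearMap.toContinuousBilinearMap_apply, QuadraticMap.associated_eq_self_apply]
  have h2 : (q : E → ℝ) =
      fun ξ => (QuadraticMap.associated q).toContinuousBilinearMap ξ ξ := funext h
  rw [h2]
  fun_prop

theorem QuadraticForm.exists_abs_le_mul_norm_sq [FiniteDimensional ℝ E]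
    (q : QuadraticForm ℝ E) : ∃ C : ℝ, 0 ≤ C ∧ ∀ ξ, |q ξ| ≤ C * ‖ξ‖ ^ 2 := by
  set b := (QuadraticMap.associated q).toContinuousBilinearMap
  refine ⟨‖b‖, b.opNorm_nonneg, fun ξ => ?_⟩
  have h : q ξ = b ξ ξ := by
    rw [LinearMap.toContinuousBilinearMap_apply, QuadraticMap.associated_eq_self_apply]
  rw [h, ← Real.norm_eq_abs, sq, ← mul_assoc]
  exact b.le_opNorm₂ ξ ξ

/-- A positive definite quadratic form on a finite-dimensional space controls the norm, by
compactness of the unit sphere. -/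
theorem QuadraticForm.exists_norm_sq_le_mul_of_pos [FiniteDimensional ℝ E]
    (q : QuadraticForm ℝ E) (hq : ∀ ξ, ξ ≠ 0 → 0 < q ξ) :
    ∃ C : ℝ, 0 ≤ C ∧ ∀ ξ, ‖ξ‖ ^ 2 ≤ C * q ξ := by
  rcases subsingleton_or_nontrivial E with hE | hE
  · refine ⟨0, le_rfl, fun ξ => ?_⟩
    simp [Subsingleton.elim ξ 0]
  have : ProperSpace E := FiniteDimensional.proper ℝ E
  obtain ⟨ζ, hζ, hmin⟩ := (isCompact_sphere (0 : E) 1).exists_isMinOn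
    (NormedSpace.sphere_nonempty.2 zero_le_one) q.continuous_of_finiteDimensional.continuousOn
  have hζ0 : 0 < q ζ := hq ζ (ne_zero_of_mem_unit_sphere ⟨ζ, hζ⟩)
  refine ⟨(q ζ)⁻¹, by positivity, fun ξ => ?_⟩
  rcases eq_or_ne ξ 0 with rfl | hξ
  · simp
  have hn : ‖ξ‖ ≠ 0 := norm_ne_zero_iff.2 hξ
  have h1 : q ζ ≤ q (‖ξ‖⁻¹ • ξ) := hmin (by simp [norm_smul, hn])
  rw [QuadraticMap.map_smul, smul_eq_mul] at h1
  rw [inv_mul_eq_div, le_div_iff₀ hζ0]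
  calc ‖ξ‖ ^ 2 * q ζ ≤ ‖ξ‖ ^ 2 * (‖ξ‖⁻¹ * ‖ξ‖⁻¹ * q ξ) := by gcongr
    _ = q ξ := by field_simp

/-- Pointwise convergence to `0` of quadratic forms on a finite-dimensional space is uniform on
the unit ball. -/
theorem QuadraticForm.eventually_le_mul_norm_sq [FiniteDimensional ℝ E]
    (q : ℕ → QuadraticForm ℝ E) (hq : ∀ ξ, Tendsto (fun t => q t ξ) atTop (𝓝 0))
    {ε : ℝ} (hε : 0 < ε) : ∀ᶠ t in atTop, ∀ ξ, q t ξ ≤ ε * ‖ξ‖ ^ 2 := by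
  let b := Module.finBasis ℝ E
  have hB : ∀ ξ η, Tendsto (fun t => QuadraticMap.associated (q t) ξ η) atTop (𝓝 0) := by
    intro ξ η
    have h := (((hq (ξ + η)).sub (hq ξ)).sub (hq η)).const_mul (2 : ℝ)⁻¹
    simpa [QuadraticMap.associated_apply] using h
  choose C hC0 hC using fun i => (show ∃ C : ℝ, 0 ≤ C ∧ ∀ ξ, |b.repr ξ i| ≤ C * ‖ξ‖ from
    ⟨‖(b.coord i).toContinuousLinearMap‖, norm_nonneg _,
      fun ξ => (b.coord i).toContinuousLinearMap.le_opNorm ξ⟩)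
  have hlim : Tendsto (fun t => ∑ i, ∑ j, C i * C j *
      |QuadraticMap.associated (q t) (b i) (b j)|) atTop (𝓝 0) := by
    have : Tendsto (fun t => ∑ i, ∑ j, C i * C j *
      |QuadraticMap.associated (q t) (b i) (b j)|) atTop (𝓝 (∑ i, ∑ j, C i * C j * |(0 : ℝ)|)) :=
      tendsto_finsetSum _ fun i _ => tendsto_finsetSum _ fun j _ =>
        ((hB (b i) (b j)).abs).const_mul _
    simpa using this
  filter_upwards [hlim.eventually_lt_const hε] with t ht ξ
  have hexp : q t ξ = ∑ i, ∑ j, b.repr ξ i * b.repr ξ j *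
      QuadraticMap.associated (q t) (b i) (b j) := by
    conv_lhs => rw [← QuadraticMap.associated_eq_self_apply ℝ (q t) ξ, ← b.sum_repr ξ]
    simp only [map_sum, map_smul, LinearMap.sum_apply, LinearMap.smul_apply, smul_eq_mul,
      Finset.mul_sum]
    rw [Finset.sum_comm]
    refine Finset.sum_congr rfl fun i _ => Finset.sum_congr rfl fun j _ => by ring
  calc q t ξ ≤ ∑ i, ∑ j, (C i * C j * |QuadraticMap.associated (q t) (b i) (b j)|) * ‖ξ‖ ^ 2 := by
        rw [hexp]
        refine Finset.sum_le_sum fun i _ => Finset.sum_le_sum fun j _ => ?_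
        refine (le_abs_self _).trans ?_
        rw [abs_mul, abs_mul]
        calc |b.repr ξ i| * |b.repr ξ j| * |QuadraticMap.associated (q t) (b i) (b j)|
            ≤ (C i * ‖ξ‖) * (C j * ‖ξ‖) * |QuadraticMap.associated (q t) (b i) (b j)| := by
              have := hC0 i
              gcongr
              · exact hC i ξ
              · exact hC j ξ
          _ = _ := by ring
    _ = (∑ i, ∑ j, C i * C j * |QuadraticMap.associated (q t) (b i) (b j)|) * ‖ξ‖ ^ 2 := by
        simp only [Finset.sum_mul]
    _ ≤ ε * ‖ξ‖ ^ 2 := by gcongr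

theorem QuadraticForm.integrable_comp_of_memLp {Ω : Type*} [MeasurableSpace Ω] {μ : Measure Ω}
    [FiniteDimensional ℝ E] (q : QuadraticForm ℝ E) {X : Ω → E}
    (hX : MemLp X 2 μ) : Integrable (fun w => q (X w)) μ := by
  obtain ⟨C, -, hC⟩ := q.exists_abs_le_mul_norm_sq
  have h2 : Integrable (fun w => ‖X w‖ ^ 2) μ := hX.norm.integrable_sq
  exact (h2.const_mul C).mono'
    (q.continuous_of_finiteDimensional.comp_aestronglyMeasurable hX.1)
    (ae_of_all _ fun w => hC (X w))

end QuadraticForms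

/-! ### The second moment operator -/

section MomentOperator

variable {E ι : Type*} [NormedAddCommGroup E] [NormedSpace ℝ E] [Fintype ι]

/-- The one-step second moment operator of the random linear recursion
`ξ_{t+1} = G ξ_t + ∑ i, ω_t^i H_i ξ_t` whose noises are centered and uncorrelated with variances
`σ_i ^ 2`: it sends a quadratic form `q` to `ξ ↦ E q (G ξ + ∑ i, ω_t^i H_i ξ)`. -/
def momentOperator (σ : ι → ℝ) (G : E →ₗ[ℝ] E) (H : ι → E →ₗ[ℝ] E) :
    QuadraticForm ℝ E →ₗ[ℝ] QuadraticForm ℝ E where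
  toFun q := q.comp G + ∑ i, σ i ^ 2 • q.comp (H i)
  map_add' p q := by
    ext ξ
    simp [mul_add, Finset.sum_add_distrib]
    ring
  map_smul' c q := by
    ext ξ
    simp [Finset.mul_sum, mul_left_comm]

variable {σ : ι → ℝ} {G : E →ₗ[ℝ] E} {H : ι → E →ₗ[ℝ] E}

theorem momentOperator_apply (q : QuadraticForm ℝ E) (ξ : E) :
    momentOperator σ G H q ξ = q (G ξ) + ∑ i, σ i ^ 2 * q (H i ξ) := by
  simp [momentOperator]

theorem momentOperator_pow_mono {p q : QuadraticForm ℝ E} (h : ∀ ξ, p ξ ≤ q ξ) (t : ℕ) (ξ : E) :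
    (momentOperator σ G H ^ t) p ξ ≤ (momentOperator σ G H ^ t) q ξ := by
  induction t generalizing ξ with
  | zero => simpa using h ξ
  | succ t ih =>
    rw [pow_succ', Module.End.mul_apply, Module.End.mul_apply, momentOperator_apply,
      momentOperator_apply]
    gcongr <;> exact ih _

theorem momentOperator_pow_nonneg {q : QuadraticForm ℝ E} (h : ∀ ξ, 0 ≤ q ξ) (t : ℕ) (ξ : E) :
    0 ≤ (momentOperator σ G H ^ t) q ξ := by
  simpa using momentOperator_pow_mono (σ := σ) (G := G) (H := H) (p := 0) (q := q) (by simpa) t ξ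

theorem momentOperator_pow_le_of_le_mul {p q : QuadraticForm ℝ E} {C : ℝ}
    (h : ∀ ξ, p ξ ≤ C * q ξ) (t : ℕ) (ξ : E) :
    (momentOperator σ G H ^ t) p ξ ≤ C * (momentOperator σ G H ^ t) q ξ := by
  simpa using momentOperator_pow_mono (σ := σ) (G := G) (H := H) (p := p) (q := C • q)
    (by simpa using h) t ξ

/-- Telescoped dissipation: if `V` decreases by at least `W` in the mean, the accumulated mean
of `W` is at most the initial value of `V`. -/
theorem sum_momentOperator_pow_le {V W : QuadraticForm ℝ E}
    (h : ∀ ξ, momentOperator σ G H V ξ + W ξ ≤ V ξ) (hV : ∀ ξ, 0 ≤ V ξ) (N : ℕ) (ξ : E) :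
    ∑ t ∈ Finset.range N, (momentOperator σ G H ^ t) W ξ ≤ V ξ := by
  have key : ∑ t ∈ Finset.range N, (momentOperator σ G H ^ t) W ξ
      + (momentOperator σ G H ^ N) V ξ ≤ V ξ := by
    induction N with
    | zero => simp
    | succ N ih =>
      have := momentOperator_pow_mono (σ := σ) (G := G) (H := H)
        (p := momentOperator σ G H V + W) (q := V) (by simpa using h) N ξ
      rw [map_add, add_apply] at this
      rw [Finset.sum_range_succ, pow_succ, Module.End.mul_apply]
      linarith
  linarith [momentOperator_pow_nonneg (σ := σ) (G := G) (H := H) hV N ξ]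

/-- If `V` decreases by at most `W` in the mean, and the mean of `V` tends to `0`, then the
accumulated mean of `W` is at least the initial value of `V`. -/
theorem le_of_sum_momentOperator_pow_le {V W : QuadraticForm ℝ E}
    (h : ∀ ξ, V ξ ≤ momentOperator σ G H V ξ + W ξ) (ξ : E)
    (hV : Tendsto (fun t => (momentOperator σ G H ^ t) V ξ) atTop (𝓝 0)) {c : ℝ}
    (hc : ∀ N, ∑ t ∈ Finset.range N, (momentOperator σ G H ^ t) W ξ ≤ c) : V ξ ≤ c := by
  have key : ∀ N, V ξ ≤ ∑ t ∈ Finset.range N, (momentOperator σ G H ^ t) W ξ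
      + (momentOperator σ G H ^ N) V ξ := by
    intro N
    induction N with
    | zero => simp
    | succ N ih =>
      have := momentOperator_pow_mono (σ := σ) (G := G) (H := H)
        (p := V) (q := momentOperator σ G H V + W) (by simpa using h) N ξ
      rw [map_add, add_apply] at this
      rw [Finset.sum_range_succ, pow_succ, Module.End.mul_apply]
      linarith
  have hlim := hV.const_add c
  rw [add_zero] at hlim
  exact ge_of_tendsto' hlim fun N => (key N).trans (by linarith [hc N])

/-- Mean-square convergence to `0` from every initial value is automatically exponential, hence
summable: some power of the moment operator halves the form `N`. -/
theorem exists_sum_momentOperator_pow_le [FiniteDimensional ℝ E] {N : QuadraticForm ℝ E}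
    (hN : ∀ ξ, ‖ξ‖ ^ 2 ≤ N ξ)
    (h : ∀ ξ, Tendsto (fun t => (momentOperator σ G H ^ t) N ξ) atTop (𝓝 0))
    (q : QuadraticForm ℝ E) (ξ : E) :
    ∃ c, ∀ T, ∑ t ∈ Finset.range T, (momentOperator σ G H ^ t) q ξ ≤ c := by
  have hN0 : ∀ ξ, 0 ≤ N ξ := fun ξ => (sq_nonneg _).trans (hN ξ)
  obtain ⟨k, hk⟩ := (QuadraticForm.eventually_le_mul_norm_sq _ h (half_pos one_pos)).exists
  have hhalf : ∀ t, (momentOperator σ G H ^ (t + k)) N ξ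
      ≤ 1 / 2 * (momentOperator σ G H ^ t) N ξ := by
    intro t
    rw [pow_add, Module.End.mul_apply]
    exact momentOperator_pow_le_of_le_mul
      (fun ξ => (hk ξ).trans (mul_le_mul_of_nonneg_left (hN ξ) (by norm_num))) t ξ
  have hsumN : ∀ T, ∑ t ∈ Finset.range T, (momentOperator σ G H ^ t) N ξ
      ≤ 2 * ∑ t ∈ Finset.range k, (momentOperator σ G H ^ t) N ξ := by
    intro T
    have h1 : ∑ t ∈ Finset.range T, (momentOperator σ G H ^ t) N ξ
        ≤ ∑ t ∈ Finset.range (k + T), (momentOperator σ G H ^ t) N ξ :=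
      Finset.sum_le_sum_of_subset_of_nonneg (by simp)
        fun t _ _ => momentOperator_pow_nonneg hN0 t ξ
    have h2 : ∑ t ∈ Finset.range T, (momentOperator σ G H ^ (k + t)) N ξ
        ≤ 1 / 2 * ∑ t ∈ Finset.range T, (momentOperator σ G H ^ t) N ξ := by
      rw [Finset.mul_sum]
      exact Finset.sum_le_sum fun t _ => by rw [add_comm]; exact hhalf t
    rw [Finset.sum_range_add] at h1
    linarith
  obtain ⟨C, hC0, hC⟩ := q.exists_abs_le_mul_norm_sq
  refine ⟨C * (2 * ∑ t ∈ Finset.range k, (momentOperator σ G H ^ t) N ξ), fun T => ?_⟩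
  calc ∑ t ∈ Finset.range T, (momentOperator σ G H ^ t) q ξ
      ≤ ∑ t ∈ Finset.range T, C * (momentOperator σ G H ^ t) N ξ :=
        Finset.sum_le_sum fun t _ => momentOperator_pow_le_of_le_mul (fun ξ =>
          ((le_abs_self _).trans (hC ξ)).trans (mul_le_mul_of_nonneg_left (hN ξ) hC0)) t ξ
    _ = C * ∑ t ∈ Finset.range T, (momentOperator σ G H ^ t) N ξ := by rw [Finset.mul_sum]
    _ ≤ _ := mul_le_mul_of_nonneg_left (hsumN T) hC0

theorem tendsto_momentOperator_pow [FiniteDimensional ℝ E] {N : QuadraticForm ℝ E}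
    (hN : ∀ ξ, ‖ξ‖ ^ 2 ≤ N ξ) {ξ : E}
    (h : Tendsto (fun t => (momentOperator σ G H ^ t) N ξ) atTop (𝓝 0))
    {q : QuadraticForm ℝ E} (hq : ∀ ξ, 0 ≤ q ξ) :
    Tendsto (fun t => (momentOperator σ G H ^ t) q ξ) atTop (𝓝 0) := by
  obtain ⟨C, hC0, hC⟩ := q.exists_abs_le_mul_norm_sq
  have hlim := h.const_mul C
  rw [mul_zero] at hlim
  exact squeeze_zero (fun t => momentOperator_pow_nonneg hq t ξ)
    (fun t => momentOperator_pow_le_of_le_mul (fun ξ =>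
          ((le_abs_self _).trans (hC ξ)).trans (mul_le_mul_of_nonneg_left (hN ξ) hC0)) t ξ) hlim

end MomentOperator

/-! ### Random linear recursions with independent noise -/

section RandomRecursion

variable {E Ω : Type*} {D : ℕ} {ω : ℕ → Ω → Fin (D + 1) → ℝ} {ξ : ℕ → Ω → E}

theorem noisePast_le [MeasurableSpace Ω] {μ : Measure Ω} {σ : Fin (D + 1) → ℝ}
    (hω : IsMultiplicativeNoise μ σ ω) (t : ℕ) : noisePast ω t ≤ ‹MeasurableSpace Ω› :=
  iSup₂_le fun s _ => (hω.measurable s).comap_le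

theorem indepFun_noise_state [MeasurableSpace Ω] {μ : Measure Ω} {σ : Fin (D + 1) → ℝ}
    [MeasurableSpace E] (hω : IsMultiplicativeNoise μ σ ω) {t : ℕ}
    (hξ : Measurable[noisePast ω t] (ξ t)) : IndepFun (ω t) (ξ t) μ := by
  have h := indep_iSup_of_disjoint (fun s => (hω.measurable s).comap_le) hω.indep
    (S := {t}) (T := {s | s < t}) (by simp)
  rw [iSup_singleton] at h
  rw [IndepFun_iff_Indep]
  exact indep_of_indep_of_le_right h (measurable_iff_comap_le.1 hξ)

variable [NormedAddCommGroup E] [NormedSpace ℝ E] [FiniteDimensional ℝ E] [MeasurableSpace E]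
  [BorelSpace E] {G : E →ₗ[ℝ] E} {H : Fin (D + 1) → E →ₗ[ℝ] E} {ξ₀ : E}

theorem measurable_noisePast (h0 : ∀ w, ξ 0 w = ξ₀)
    (hs : ∀ t w, ξ (t + 1) w = G (ξ t w) + ∑ i, ω t w i • H i (ξ t w)) (t : ℕ) :
    Measurable[noisePast ω t] (ξ t) := by
  induction t with
  | zero =>
    have : ξ 0 = fun _ => ξ₀ := funext h0
    rw [this]
    exact measurable_const
  | succ t ih =>
    have hle : noisePast ω t ≤ noisePast ω (t + 1) :=
      iSup₂_mono' fun s hs => ⟨s, Nat.lt_succ_of_lt hs, le_rfl⟩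
    have hω : Measurable[noisePast ω (t + 1)] (ω t) := by
      rw [measurable_iff_comap_le]
      exact le_iSup₂_of_le t (Nat.lt_succ_self t) le_rfl
    have hξ : Measurable[noisePast ω (t + 1)] (ξ t) := ih.mono hle le_rfl
    have : ξ (t + 1) = (fun z : (Fin (D + 1) → ℝ) × E => G z.2 + ∑ i, z.1 i • H i z.2) ∘
        fun w => (ω t w, ξ t w) := funext (hs t)
    rw [this]
    refine Measurable.comp (Continuous.measurable ?_) (hω.prodMk hξ)
    have hG := G.continuous_of_finiteDimensional
    have hH := fun i => (H i).continuous_of_finiteDimensional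
    fun_prop

variable [MeasurableSpace Ω] {μ : Measure Ω} [IsProbabilityMeasure μ] {σ : Fin (D + 1) → ℝ}

theorem memLp_randomRecursion (hω : IsMultiplicativeNoise μ σ ω) (h0 : ∀ w, ξ 0 w = ξ₀)
    (hs : ∀ t w, ξ (t + 1) w = G (ξ t w) + ∑ i, ω t w i • H i (ξ t w)) (t : ℕ) :
    MemLp (ξ t) 2 μ := by
  induction t with
  | zero =>
    have : ξ 0 = fun _ => ξ₀ := funext h0
    rw [this]
    exact memLp_const _
  | succ t ih =>
    have hmeas := measurable_noisePast h0 hs t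
    have hind := indepFun_noise_state hω hmeas
    have : ξ (t + 1) = fun w => G.toContinuousLinearMap (ξ t w) +
        ∑ i, ω t w i • (H i).toContinuousLinearMap (ξ t w) := funext (hs t)
    rw [this]
    refine (G.toContinuousLinearMap.comp_memLp' ih).add (memLp_finsetSum _ fun i _ => ?_)
    have hω1 := hω.memLp t i
    have hH := (H i).toContinuousLinearMap.comp_memLp' ih
    have hsmul : AEStronglyMeasurable
        (fun w => ω t w i • (H i).toContinuousLinearMap (ξ t w)) μ := hω1.1.smul hH.1
    rw [memLp_two_iff_integrable_sq_norm hsmul]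
    have hprod : IndepFun (fun w => ω t w i ^ 2)
        (fun w => ‖(H i).toContinuousLinearMap (ξ t w)‖ ^ 2) μ :=
      hind.comp (φ := fun z : Fin (D + 1) → ℝ => z i ^ 2)
        (ψ := fun z => ‖(H i).toContinuousLinearMap z‖ ^ 2) (by fun_prop)
        (by
          have := (H i).toContinuousLinearMap.continuous
          exact Continuous.measurable (by fun_prop))
    refine (hprod.integrable_mul hω1.integrable_sq hH.norm.integrable_sq).congr
      (ae_of_all _ fun w => ?_)
    simp [norm_smul, mul_pow]

/-- The moment operator propagates second moments: by independence of the noise and the state,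
the terms that are linear in the noise have mean zero and the mixed noise terms cancel. -/
theorem integral_quadraticForm_succ (hω : IsMultiplicativeNoise μ σ ω) (h0 : ∀ w, ξ 0 w = ξ₀)
    (hs : ∀ t w, ξ (t + 1) w = G (ξ t w) + ∑ i, ω t w i • H i (ξ t w)) (q : QuadraticForm ℝ E)
    (t : ℕ) :
    ∫ w, q (ξ (t + 1) w) ∂μ = ∫ w, momentOperator σ G H q (ξ t w) ∂μ := by
  have hmeas := measurable_noisePast h0 hs t
  have hmeas' : Measurable (ξ t) := hmeas.mono (noisePast_le hω t) le_rfl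
  have hind := indepFun_noise_state hω hmeas
  have hLp := memLp_randomRecursion hω h0 hs t
  let b := QuadraticMap.associated q
  have hqb : ∀ η, q η = b η η := fun η => (QuadraticMap.associated_eq_self_apply ℝ q η).symm
  let q1 : Fin (D + 1) → QuadraticForm ℝ E := fun i =>
    LinearMap.BilinMap.toQuadraticMap (b.compl₁₂ G (H i) + b.compl₁₂ (H i) G)
  let q2 : Fin (D + 1) → Fin (D + 1) → QuadraticForm ℝ E := fun i j =>
    LinearMap.BilinMap.toQuadraticMap (b.compl₁₂ (H i) (H j))
  have hexp : ∀ w, q (ξ (t + 1) w) = q (G (ξ t w)) + ∑ i, ω t w i * q1 i (ξ t w)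
      + ∑ i, ∑ j, (ω t w i * ω t w j) * q2 i j (ξ t w) := by
    intro w
    simp only [hqb, hs, map_add, map_sum, map_smul, LinearMap.add_apply, LinearMap.sum_apply,
      LinearMap.smul_apply, smul_eq_mul, q1, q2, LinearMap.BilinMap.toQuadraticMap_apply,
      LinearMap.compl₁₂_apply, mul_add, Finset.sum_add_distrib, Finset.mul_sum]
    rw [Finset.sum_comm (f := fun i j => ω t w i * (ω t w j * b (H j (ξ t w)) (H i (ξ t w))))]
    simp only [mul_assoc, mul_left_comm]
    ring
  have hprod : ∀ (f : (Fin (D + 1) → ℝ) → ℝ) (p : QuadraticForm ℝ E), Continuous f →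
      Integrable (fun w => f (ω t w)) μ →
      Integrable (fun w => f (ω t w) * p (ξ t w)) μ ∧
      ∫ w, f (ω t w) * p (ξ t w) ∂μ = (∫ w, f (ω t w) ∂μ) * ∫ w, p (ξ t w) ∂μ := by
    intro f p hf hfi
    have hp := p.continuous_of_finiteDimensional
    have hi : IndepFun (fun w => f (ω t w)) (fun w => p (ξ t w)) μ :=
      hind.comp hf.measurable hp.measurable
    exact ⟨hi.integrable_mul hfi (p.integrable_comp_of_memLp hLp),
      hind.integral_fun_comp_mul_comp (hω.measurable t).aemeasurable hmeas'.aemeasurable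
        hf.aestronglyMeasurable hp.aestronglyMeasurable⟩
  have hlin := fun i => hprod (fun z => z i) (q1 i) (by fun_prop)
    ((hω.memLp t i).integrable one_le_two)
  have hquad := fun i j => hprod (fun z => z i * z j) (q2 i j) (by fun_prop)
    ((hω.memLp t i).integrable_mul (hω.memLp t j))
  simp only [hexp, momentOperator_apply]
  have hG : Integrable (fun w => q (G (ξ t w))) μ :=
    QuadraticForm.integrable_comp_of_memLp (q.comp G) hLp
  have hH : ∀ i, Integrable (fun w => q (H i (ξ t w))) μ :=
    fun i => QuadraticForm.integrable_comp_of_memLp (q.comp (H i)) hLp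
  have hlinI : Integrable (fun w => ∑ i, ω t w i * q1 i (ξ t w)) μ :=
    integrable_finsetSum _ fun i _ => (hlin i).1
  have hquadI : ∀ i, Integrable (fun w => ∑ j, ω t w i * ω t w j * q2 i j (ξ t w)) μ :=
    fun i => integrable_finsetSum _ fun j _ => (hquad i j).1
  have hGlin : Integrable (fun w => q (G (ξ t w)) + ∑ i, ω t w i * q1 i (ξ t w)) μ := hG.add hlinI
  rw [integral_add hGlin (integrable_finsetSum _ fun i _ => hquadI i),
    integral_add hG hlinI,
    integral_add hG (integrable_finsetSum _ fun i _ => (hH i).const_mul _),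
    integral_finsetSum _ fun i _ => (hlin i).1,
    integral_finsetSum _ fun i _ => hquadI i,
    integral_finsetSum _ fun i _ => (hH i).const_mul _]
  simp only [fun i => integral_finsetSum Finset.univ fun j _ => (hquad i j).1]
  simp only [(hlin _).2, (hquad _ _).2, hω.mean, hω.cov, ite_mul, zero_mul,
    Finset.sum_const_zero, add_zero, Finset.sum_ite_eq, Finset.mem_univ, if_true,
    integral_const_mul]
  simp only [q2, hqb, LinearMap.BilinMap.toQuadraticMap_apply, LinearMap.compl₁₂_apply]

theorem integral_quadraticForm (hω : IsMultiplicativeNoise μ σ ω) (h0 : ∀ w, ξ 0 w = ξ₀)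
    (hs : ∀ t w, ξ (t + 1) w = G (ξ t w) + ∑ i, ω t w i • H i (ξ t w)) (q : QuadraticForm ℝ E)
    (t : ℕ) :
    ∫ w, q (ξ t w) ∂μ = (momentOperator σ G H ^ t) q ξ₀ := by
  induction t generalizing q with
  | zero => simp [h0]
  | succ t ih =>
    rw [integral_quadraticForm_succ hω h0 hs, ih, pow_succ, Module.End.mul_apply]

end RandomRecursion

/-! ### Matrices as quadratic forms -/

/-- The quadratic form `v ↦ v' M v` of a square matrix. -/
def Matrix.quadForm {k : ℕ} (M : Matrix (Fin k) (Fin k) ℝ) : QuadraticForm ℝ (Fin k → ℝ) :=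
  LinearMap.BilinMap.toQuadraticMap (Matrix.toBilin' M)

theorem Matrix.quadForm_apply {k : ℕ} (M : Matrix (Fin k) (Fin k) ℝ) (v : Fin k → ℝ) :
    M.quadForm v = v ⬝ᵥ M *ᵥ v := by
  rw [Matrix.quadForm, LinearMap.BilinMap.toQuadraticMap_apply, Matrix.toBilin'_apply']

theorem Matrix.dotProduct_transpose_mul_mulVec {k l : ℕ} (M : Matrix (Fin k) (Fin k) ℝ)
    (N : Matrix (Fin k) (Fin l) ℝ) (v w : Fin l → ℝ) :
    v ⬝ᵥ (Nᵀ * M * N) *ᵥ w = (N *ᵥ v) ⬝ᵥ M *ᵥ (N *ᵥ w) := by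
  rw [← Matrix.mulVec_mulVec, ← Matrix.mulVec_mulVec, Matrix.dotProduct_mulVec,
    Matrix.vecMul_transpose]

theorem Matrix.IsSymm.dotProduct_mulVec_comm {k : ℕ} {M : Matrix (Fin k) (Fin k) ℝ} (h : M.IsSymm)
    (v w : Fin k → ℝ) : v ⬝ᵥ M *ᵥ w = w ⬝ᵥ M *ᵥ v := by
  rw [Matrix.dotProduct_mulVec, ← Matrix.mulVec_transpose, h.eq, dotProduct_comm]

/-- Completion of the square. -/
theorem Matrix.IsSymm.dotProduct_mulVec_completeSquare {k : ℕ} {P : Matrix (Fin k) (Fin k) ℝ}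
    (h : P.IsSymm) (hP : IsUnit P.det) (v g : Fin k → ℝ) :
    v ⬝ᵥ P *ᵥ v + 2 * (v ⬝ᵥ g) =
      (v + P⁻¹ *ᵥ g) ⬝ᵥ P *ᵥ (v + P⁻¹ *ᵥ g) - g ⬝ᵥ P⁻¹ *ᵥ g := by
  have h1 : P *ᵥ (P⁻¹ *ᵥ g) = g := by
    rw [Matrix.mulVec_mulVec, Matrix.mul_nonsing_inv _ hP, Matrix.one_mulVec]
  rw [Matrix.mulVec_add, dotProduct_add, add_dotProduct, add_dotProduct, h1,
    h.dotProduct_mulVec_comm (P⁻¹ *ᵥ g) v, h1, dotProduct_comm (P⁻¹ *ᵥ g) g]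
  ring

/-! ### The augmented state, the predictor and the storage function -/

namespace MultiDelaySystem

variable {n m D : ℕ} (S : MultiDelaySystem n m D)

/-- The augmented state `(x_t, (u_{t-1}, …, u_{t-D}))`. -/
abbrev AugState (n m D : ℕ) : Type := (Fin n → ℝ) × (Fin D → Fin m → ℝ)

/-- The inputs `u_{t-τ}`, `0 ≤ τ ≤ D`, as linear functions of the augmented state, when the current
input is the linear function `v` of it. -/
def inputHistory (v : AugState n m D →ₗ[ℝ] (Fin m → ℝ)) (τ : Fin (D + 1)) :
    AugState n m D →ₗ[ℝ] (Fin m → ℝ) :=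
  Fin.cases v (fun i => LinearMap.proj i ∘ₗ LinearMap.snd ℝ _ _) τ

@[simp]
theorem inputHistory_zero (v : AugState n m D →ₗ[ℝ] (Fin m → ℝ)) : inputHistory v 0 = v := rfl

@[simp]
theorem inputHistory_succ (v : AugState n m D →ₗ[ℝ] (Fin m → ℝ)) (i : Fin D)
    (ξ : AugState n m D) : inputHistory v i.succ ξ = ξ.2 i := rfl

/-- The noise-free part of the closed-loop transition of the augmented state. -/
def drift (v : AugState n m D →ₗ[ℝ] (Fin m → ℝ)) : AugState n m D →ₗ[ℝ] AugState n m D :=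
  ((S.A.mulVecLin ∘ₗ LinearMap.fst ℝ _ _) +
    ∑ τ, (S.B τ).mulVecLin ∘ₗ inputHistory v τ).prod
    (LinearMap.pi fun i => inputHistory v i.castSucc)

/-- The coefficient of the noise `ω_t^τ` in the closed-loop transition of the augmented state. -/
def diffusion (v : AugState n m D →ₗ[ℝ] (Fin m → ℝ)) (τ : Fin (D + 1)) :
    AugState n m D →ₗ[ℝ] AugState n m D :=
  ((S.C τ).mulVecLin ∘ₗ inputHistory v τ).prod 0

variable (v : AugState n m D →ₗ[ℝ] (Fin m → ℝ)) (ξ : AugState n m D)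

theorem drift_fst : (S.drift v ξ).1 = S.A *ᵥ ξ.1 + ∑ τ, S.B τ *ᵥ inputHistory v τ ξ := by
  simp [drift]

theorem drift_snd (i : Fin D) : (S.drift v ξ).2 i = inputHistory v i.castSucc ξ := by
  simp [drift]

theorem diffusion_fst (τ : Fin (D + 1)) :
    (S.diffusion v τ ξ).1 = S.C τ *ᵥ inputHistory v τ ξ := by
  simp [diffusion]

theorem diffusion_snd (τ : Fin (D + 1)) : (S.diffusion v τ ξ).2 = 0 := by
  simp [diffusion]

/-- The predictor: the state that the noise-free system reaches `D` steps later when all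
current and future inputs vanish. It is a linear function of the augmented state. -/
def predictor : AugState n m D →ₗ[ℝ] (Fin n → ℝ) :=
  (S.A ^ D).mulVecLin ∘ₗ LinearMap.fst ℝ _ _ +
    ∑ i : Fin D, ∑ j ∈ Finset.Ici i.succ,
      (S.A ^ (D + i - j) * S.B j).mulVecLin ∘ₗ LinearMap.proj i ∘ₗ LinearMap.snd ℝ _ _

theorem predictor_apply : S.predictor ξ = S.A ^ D *ᵥ ξ.1 +
    ∑ i : Fin D, ∑ j ∈ Finset.Ici i.succ, (S.A ^ (D + i - j) * S.B j) *ᵥ ξ.2 i := by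
  simp [predictor]

/-- Each input enters the predictor at once through `L`: the predictor of the noise-free
system has no input delay. -/
theorem predictor_drift :
    S.predictor (S.drift v ξ) = S.A *ᵥ S.predictor ξ + S.L *ᵥ v ξ := by
  set F : Fin (D + 1) → Fin n → ℝ := fun k => ∑ j ∈ Finset.Ici k,
    (S.A ^ (D + k - j) * S.B j) *ᵥ inputHistory v k ξ with hF
  -- The input with lag `k` acts now through channel `k` and later through the channels `j > k`.
  have hsplit : ∀ k, F k = S.A ^ D *ᵥ (S.B k *ᵥ inputHistory v k ξ) +
      ∑ j ∈ Finset.Ioi k, (S.A ^ (D + k - j) * S.B j) *ᵥ inputHistory v k ξ := by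
    intro k
    simp only [hF]
    rw [← Finset.Ioi_insert, Finset.sum_insert (by simp), Matrix.mulVec_mulVec, Nat.add_sub_cancel]
  have hIoi : ∀ i : Fin D, Finset.Ioi i.castSucc = Finset.Ici i.succ := by
    intro i
    ext j
    simp [Fin.castSucc_lt_iff_succ_le]
  have hlast : Finset.Ioi (Fin.last D) = ∅ := by
    ext j
    simp [Fin.le_last]
  have h1 : S.predictor (S.drift v ξ) = S.A ^ D *ᵥ (S.A *ᵥ ξ.1) + ∑ k, F k := by
    rw [predictor_apply, drift_fst, Matrix.mulVec_add, Matrix.mulVec_sum, add_assoc]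
    congr 1
    simp only [hsplit, Finset.sum_add_distrib]
    congr 1
    rw [Fin.sum_univ_castSucc (fun k => ∑ j ∈ Finset.Ioi k, _), hlast]
    simp [hIoi, drift_snd]
  have h0 : F 0 = S.L *ᵥ v ξ := by
    have : Finset.Ici (0 : Fin (D + 1)) = Finset.univ := by ext; simp
    simp [hF, this, L, Matrix.sum_mulVec]
  have hA : S.A ^ D *ᵥ (S.A *ᵥ ξ.1) = S.A *ᵥ (S.A ^ D *ᵥ ξ.1) := by
    rw [Matrix.mulVec_mulVec, Matrix.mulVec_mulVec, ← pow_succ, pow_succ']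
  have hs : ∀ i : Fin D, F i.succ = S.A *ᵥ
      ∑ j ∈ Finset.Ici i.succ, (S.A ^ (D + i - j) * S.B j) *ᵥ ξ.2 i := by
    intro i
    rw [hF, Matrix.mulVec_sum]
    refine Finset.sum_congr rfl fun j _ => ?_
    have hj : D + (i.succ : ℕ) - j = (D + i - j) + 1 := by
      have := j.is_le
      simp only [Fin.val_succ]
      omega
    rw [Matrix.mulVec_mulVec, ← Matrix.mul_assoc, ← pow_succ', hj, inputHistory_succ]
  rw [h1, Fin.sum_univ_succ, h0, hA, predictor_apply, Matrix.mulVec_add, Matrix.mulVec_sum]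
  simp only [hs]
  abel

theorem predictor_diffusion (τ : Fin (D + 1)) :
    S.predictor (S.diffusion v τ ξ) = S.A ^ D *ᵥ (S.C τ *ᵥ inputHistory v τ ξ) := by
  rw [predictor_apply, diffusion_snd, diffusion_fst]
  simp

/-- The matrix of the quadratic form `u ↦ (A^D C_τ u)' Z (A^D C_τ u)`. -/
def delayWeight (Z : Matrix (Fin n) (Fin n) ℝ) (τ : Fin (D + 1)) : Matrix (Fin m) (Fin m) ℝ :=
  (S.C τ)ᵀ * S.Aᵀ ^ D * Z * S.A ^ D * S.C τ

theorem delayWeight_eq (Z : Matrix (Fin n) (Fin n) ℝ) (τ : Fin (D + 1)) :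
    S.delayWeight Z τ = (S.A ^ D * S.C τ)ᵀ * Z * (S.A ^ D * S.C τ) := by
  rw [delayWeight, Matrix.transpose_mul, Matrix.transpose_pow]
  simp only [Matrix.mul_assoc]

theorem dotProduct_delayWeight (Z : Matrix (Fin n) (Fin n) ℝ) (τ : Fin (D + 1))
    (u : Fin m → ℝ) : u ⬝ᵥ S.delayWeight Z τ *ᵥ u =
      (S.A ^ D *ᵥ (S.C τ *ᵥ u)) ⬝ᵥ Z *ᵥ (S.A ^ D *ᵥ (S.C τ *ᵥ u)) := by
  rw [delayWeight_eq, Matrix.dotProduct_transpose_mul_mulVec]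
  simp only [Matrix.mulVec_mulVec]

/-- The storage function of `Z`: the form `y' Z y` of the predictor `y`, plus the mean energy
that the past inputs will still inject into the predictor through the delayed noise channels. -/
def storage (Z : Matrix (Fin n) (Fin n) ℝ) : QuadraticForm ℝ (AugState n m D) :=
  Z.quadForm.comp S.predictor + ∑ τ : Fin (D + 1), S.σ τ ^ 2 •
    ∑ i : Fin D, if i.castSucc < τ then
      (S.delayWeight Z τ).quadForm.comp (LinearMap.proj i ∘ₗ LinearMap.snd ℝ _ _) else 0

theorem storage_apply (Z : Matrix (Fin n) (Fin n) ℝ) :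
    S.storage Z ξ = S.predictor ξ ⬝ᵥ Z *ᵥ S.predictor ξ +
      ∑ τ : Fin (D + 1), S.σ τ ^ 2 * ∑ i : Fin D, if i.castSucc < τ then
        ξ.2 i ⬝ᵥ S.delayWeight Z τ *ᵥ ξ.2 i else 0 := by
  have : ∀ (p : Prop) [Decidable p] (q : QuadraticForm ℝ (AugState n m D)),
      (if p then q else 0) ξ = if p then q ξ else 0 := by
    intro p _ q
    split_ifs <;> rfl
  simp [storage, Matrix.quadForm_apply, this]

theorem storage_nonneg {Z : Matrix (Fin n) (Fin n) ℝ} (hZ : ∀ y, 0 ≤ y ⬝ᵥ Z *ᵥ y) :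
    0 ≤ S.storage Z ξ := by
  rw [storage_apply]
  refine add_nonneg (hZ _) (Finset.sum_nonneg fun τ _ => mul_nonneg (sq_nonneg _)
    (Finset.sum_nonneg fun i _ => ?_))
  split_ifs
  · rw [dotProduct_delayWeight]
    exact hZ _
  · exact le_rfl

/-- The mean of `y_{t+1}' Z y_{t+1}` in the undelayed surrogate system
`y_{t+1} = A y_t + L u_t + ∑ τ, ω_t^τ A^D C_τ u_t`, as a function of `y_t` and `u_t`. -/
def surrogateStep (Z : Matrix (Fin n) (Fin n) ℝ) (y : Fin n → ℝ) (u : Fin m → ℝ) : ℝ :=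
  (S.A *ᵥ y + S.L *ᵥ u) ⬝ᵥ Z *ᵥ (S.A *ᵥ y + S.L *ᵥ u) +
    ∑ τ, S.σ τ ^ 2 * (u ⬝ᵥ S.delayWeight Z τ *ᵥ u)

/-- The storage function turns the delayed noise into undelayed noise: it changes in the mean
exactly as `y' Z y` does in the undelayed surrogate system. -/
theorem momentOperator_storage (Z : Matrix (Fin n) (Fin n) ℝ) :
    momentOperator S.σ (S.drift v) (S.diffusion v) (S.storage Z) ξ =
      S.storage Z ξ - S.predictor ξ ⬝ᵥ Z *ᵥ S.predictor ξ +
        S.surrogateStep Z (S.predictor ξ) (v ξ) := by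
  -- Both sides are the sum of `f` over the lags `0, …, τ`.
  have hshift : ∀ (τ : Fin (D + 1)) (f : Fin (D + 1) → ℝ),
      (∑ i : Fin D, if i.castSucc < τ then f i.castSucc else 0) + f τ =
        f 0 + ∑ i : Fin D, if i.castSucc < τ then f i.succ else 0 := by
    intro τ f
    have h1 : ∑ k : Fin (D + 1), (if k ≤ τ then f k else 0) =
        (∑ i : Fin D, if i.castSucc < τ then f i.castSucc else 0) + f τ := by
      have : ∀ k : Fin (D + 1), (if k ≤ τ then f k else 0) =
          (if k < τ then f k else 0) + if k = τ then f k else 0 := by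
        intro k
        rcases lt_trichotomy k τ with h | h | h
        · simp [h, h.le, h.ne]
        · simp [h]
        · simp [h.not_ge, h.not_gt, h.ne']
      simp only [this, Finset.sum_add_distrib, Finset.sum_ite_eq', Finset.mem_univ, if_true]
      rw [Fin.sum_univ_castSucc]
      simp [(Fin.le_last τ).not_gt]
    rw [← h1, Fin.sum_univ_succ]
    simp [Fin.castSucc_lt_iff_succ_le]
  have hdiff : ∀ τ, S.storage Z (S.diffusion v τ ξ) =
      inputHistory v τ ξ ⬝ᵥ S.delayWeight Z τ *ᵥ inputHistory v τ ξ := by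
    intro τ
    rw [storage_apply, predictor_diffusion, diffusion_snd, dotProduct_delayWeight]
    simp
  rw [momentOperator_apply, storage_apply, storage_apply, predictor_drift]
  simp only [hdiff, drift_snd, surrogateStep]
  have hsum : ∀ τ : Fin (D + 1), S.σ τ ^ 2 * (∑ i : Fin D, if i.castSucc < τ then
        inputHistory v i.castSucc ξ ⬝ᵥ S.delayWeight Z τ *ᵥ inputHistory v i.castSucc ξ else 0) +
      S.σ τ ^ 2 * (inputHistory v τ ξ ⬝ᵥ S.delayWeight Z τ *ᵥ inputHistory v τ ξ) =
      S.σ τ ^ 2 * (v ξ ⬝ᵥ S.delayWeight Z τ *ᵥ v ξ) +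
      S.σ τ ^ 2 * (∑ i : Fin D, if i.castSucc < τ then
        ξ.2 i ⬝ᵥ S.delayWeight Z τ *ᵥ ξ.2 i else 0) := by
    intro τ
    rw [← mul_add, ← mul_add, hshift τ fun k =>
      inputHistory v k ξ ⬝ᵥ S.delayWeight Z τ *ᵥ inputHistory v k ξ]
    simp
  have := Finset.sum_congr (rfl : (Finset.univ : Finset (Fin (D + 1))) = Finset.univ)
    fun τ _ => hsum τ
  rw [Finset.sum_add_distrib, Finset.sum_add_distrib] at this
  linarith

end MultiDelaySystem

/-! ### The Riccati equation and its value iteration -/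

theorem Matrix.PosSemidef.isSymm {k : ℕ} {M : Matrix (Fin k) (Fin k) ℝ} (h : M.PosSemidef) :
    M.IsSymm := by
  have := h.isHermitian.eq
  rwa [Matrix.conjTranspose_eq_transpose_of_trivial] at this

theorem Matrix.PosSemidef.transpose_mul_mul_same {k l : ℕ} {M : Matrix (Fin k) (Fin k) ℝ}
    (h : M.PosSemidef) (N : Matrix (Fin k) (Fin l) ℝ) : (Nᵀ * M * N).PosSemidef := by
  simpa using h.conjTranspose_mul_mul_same N

theorem Matrix.PosSemidef.dotProduct_nonneg {k : ℕ} {M : Matrix (Fin k) (Fin k) ℝ}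
    (h : M.PosSemidef) (v : Fin k → ℝ) : 0 ≤ v ⬝ᵥ M *ᵥ v := by
  simpa using h.dotProduct_mulVec_nonneg v

theorem Matrix.PosDef.dotProduct_pos {k : ℕ} {M : Matrix (Fin k) (Fin k) ℝ}
    (h : M.PosDef) {v : Fin k → ℝ} (hv : v ≠ 0) : 0 < v ⬝ᵥ M *ᵥ v := by
  simpa using h.dotProduct_mulVec_pos hv

theorem Matrix.PosSemidef.of_isSymm {k : ℕ} {M : Matrix (Fin k) (Fin k) ℝ} (h : M.IsSymm)
    (h0 : ∀ v, 0 ≤ v ⬝ᵥ M *ᵥ v) : M.PosSemidef :=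
  .of_dotProduct_mulVec_nonneg
    (by rw [Matrix.IsHermitian, Matrix.conjTranspose_eq_transpose_of_trivial, h.eq])
    (by simpa using h0)

/-- Polarization: an entry of a symmetric matrix in terms of its quadratic form. -/
theorem Matrix.IsSymm.apply_eq_polar {k : ℕ} {M : Matrix (Fin k) (Fin k) ℝ} (h : M.IsSymm)
    (i j : Fin k) : M i j = 2⁻¹ * (M.quadForm (Pi.single i 1 + Pi.single j 1) -
      M.quadForm (Pi.single i 1) - M.quadForm (Pi.single j 1)) := by
  have hij : M j i = M i j := h.apply i j
  simp only [Matrix.quadForm_apply, Matrix.mulVec_add, dotProduct_add, add_dotProduct,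
    Matrix.mulVec_single_one, single_one_dotProduct, Matrix.col_apply, hij]
  ring

namespace MultiDelaySystem

variable {n m D : ℕ} (S : MultiDelaySystem n m D)

variable {R : Matrix (Fin m) (Fin m) ℝ} {Q Z : Matrix (Fin n) (Fin n) ℝ}

theorem posSemidef_delayWeight (hZ : Z.PosSemidef) (τ : Fin (D + 1)) :
    (S.delayWeight Z τ).PosSemidef := by
  rw [delayWeight_eq]
  exact hZ.transpose_mul_mul_same _

theorem posDef_U (hR : R.PosDef) (hQ : Q.PosSemidef) : (S.U R Q).PosDef := by
  refine hR.add_posSemidef (Matrix.posSemidef_sum _ fun τ _ =>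
    Matrix.posSemidef_sum _ fun h _ => ?_)
  refine Matrix.PosSemidef.smul ?_ (sq_nonneg _)
  have : (S.C τ)ᵀ * S.Aᵀ ^ (D - h) * Q * S.A ^ (D - h) * S.C τ =
      (S.A ^ (D - h) * S.C τ)ᵀ * Q * (S.A ^ (D - h) * S.C τ) := by
    rw [Matrix.transpose_mul, Matrix.transpose_pow]
    simp only [Matrix.mul_assoc]
  rw [this]
  exact hQ.transpose_mul_mul_same _

theorem Ψ_eq : S.Ψ R Q Z = S.Lᵀ * Z * S.L + ∑ τ, S.σ τ ^ 2 • S.delayWeight Z τ + S.U R Q := rfl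

theorem posDef_Ψ (hR : R.PosDef) (hQ : Q.PosSemidef) (hZ : Z.PosSemidef) :
    (S.Ψ R Q Z).PosDef := by
  rw [Ψ_eq]
  exact (S.posDef_U hR hQ).posSemidef_add ((hZ.transpose_mul_mul_same _).add
    (Matrix.posSemidef_sum _ fun τ _ => (S.posSemidef_delayWeight hZ τ).smul (sq_nonneg _)))

/-- The Riccati map: `Z` solves the Riccati equation if and only if it is a fixed point. -/
def riccatiStep (R : Matrix (Fin m) (Fin m) ℝ) (Q Z : Matrix (Fin n) (Fin n) ℝ) :
    Matrix (Fin n) (Fin n) ℝ :=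
  S.Aᵀ * Z * S.A + Q - S.Aᵀ * Z * S.L * (S.Ψ R Q Z)⁻¹ * S.Lᵀ * Z * S.A

theorem DDARE_iff : S.DDARE R Q Z ↔ S.riccatiStep R Q Z = Z := by
  rw [DDARE, riccatiStep, ← sub_eq_zero (b := Z)]
  constructor <;> intro h <;> rw [← h] <;> abel

/-- The gain `Ψ⁻¹ L' Z A` of the predictor feedback. -/
def riccatiGain (R : Matrix (Fin m) (Fin m) ℝ) (Q Z : Matrix (Fin n) (Fin n) ℝ) :
    Matrix (Fin m) (Fin n) ℝ :=
  (S.Ψ R Q Z)⁻¹ * S.Lᵀ * Z * S.A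

/-- The stage cost `y' Q y + u' U u` as a function of the predictor `y` and the input `u`. -/
def stageCost (R : Matrix (Fin m) (Fin m) ℝ) (Q : Matrix (Fin n) (Fin n) ℝ) (y : Fin n → ℝ)
    (u : Fin m → ℝ) : ℝ :=
  y ⬝ᵥ Q *ᵥ y + u ⬝ᵥ S.U R Q *ᵥ u

/-- Bellman identity: `riccatiStep` is the minimum over `u` of the stage cost plus the cost `Z` of
the next state of the undelayed surrogate system, attained at `u = -riccatiGain y`. -/
theorem stageCost_add_surrogateStep (hR : R.PosDef) (hQ : Q.PosSemidef) (hZ : Z.PosSemidef)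
    (y : Fin n → ℝ) (u : Fin m → ℝ) :
    S.stageCost R Q y u + S.surrogateStep Z y u = y ⬝ᵥ S.riccatiStep R Q Z *ᵥ y +
      (u + S.riccatiGain R Q Z *ᵥ y) ⬝ᵥ S.Ψ R Q Z *ᵥ (u + S.riccatiGain R Q Z *ᵥ y) := by
  have hΨ := S.posDef_Ψ hR hQ hZ
  have hdet : IsUnit (S.Ψ R Q Z).det := hΨ.det_pos.ne'.isUnit
  set g := S.Lᵀ *ᵥ (Z *ᵥ (S.A *ᵥ y)) with hg
  have hK : S.riccatiGain R Q Z *ᵥ y = (S.Ψ R Q Z)⁻¹ *ᵥ g := by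
    rw [hg, riccatiGain]
    simp only [Matrix.mulVec_mulVec, Matrix.mul_assoc]
  have hsq := hΨ.posSemidef.isSymm.dotProduct_mulVec_completeSquare hdet u g
  rw [hK]
  have hcross : u ⬝ᵥ g = (S.L *ᵥ u) ⬝ᵥ Z *ᵥ (S.A *ᵥ y) := by
    rw [hg, Matrix.dotProduct_mulVec, Matrix.vecMul_transpose]
  have hΨu : u ⬝ᵥ S.Ψ R Q Z *ᵥ u = (S.L *ᵥ u) ⬝ᵥ Z *ᵥ (S.L *ᵥ u) +
      ∑ τ, S.σ τ ^ 2 * (u ⬝ᵥ S.delayWeight Z τ *ᵥ u) + u ⬝ᵥ S.U R Q *ᵥ u := by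
    rw [Ψ_eq, Matrix.add_mulVec, Matrix.add_mulVec, dotProduct_add, dotProduct_add,
      Matrix.dotProduct_transpose_mul_mulVec, Matrix.sum_mulVec, dotProduct_sum]
    simp [Matrix.smul_mulVec]
  have hstep : y ⬝ᵥ S.riccatiStep R Q Z *ᵥ y = (S.A *ᵥ y) ⬝ᵥ Z *ᵥ (S.A *ᵥ y) + y ⬝ᵥ Q *ᵥ y -
      g ⬝ᵥ (S.Ψ R Q Z)⁻¹ *ᵥ g := by
    have : S.Aᵀ * Z * S.L * (S.Ψ R Q Z)⁻¹ * S.Lᵀ * Z * S.A =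
        (S.Lᵀ * Z * S.A)ᵀ * (S.Ψ R Q Z)⁻¹ * (S.Lᵀ * Z * S.A) := by
      simp only [Matrix.transpose_mul, Matrix.transpose_transpose, hZ.isSymm.eq, Matrix.mul_assoc]
    rw [riccatiStep, Matrix.sub_mulVec, Matrix.add_mulVec, dotProduct_sub, dotProduct_add,
      Matrix.dotProduct_transpose_mul_mulVec, this,
      Matrix.dotProduct_transpose_mul_mulVec]
    simp only [hg, Matrix.mulVec_mulVec, Matrix.mul_assoc]
  rw [stageCost, surrogateStep, hstep, Matrix.mulVec_add, dotProduct_add, add_dotProduct,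
    add_dotProduct, hZ.isSymm.dotProduct_mulVec_comm (S.A *ᵥ y) (S.L *ᵥ u)]
  linarith

theorem le_stageCost_add_surrogateStep (hR : R.PosDef) (hQ : Q.PosSemidef) (hZ : Z.PosSemidef)
    (y : Fin n → ℝ) (u : Fin m → ℝ) :
    y ⬝ᵥ S.riccatiStep R Q Z *ᵥ y ≤ S.stageCost R Q y u + S.surrogateStep Z y u := by
  rw [S.stageCost_add_surrogateStep hR hQ hZ]
  linarith [(S.posDef_Ψ hR hQ hZ).posSemidef.dotProduct_nonneg (u + S.riccatiGain R Q Z *ᵥ y)]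

theorem stageCost_add_surrogateStep_riccatiGain (hR : R.PosDef) (hQ : Q.PosSemidef)
    (hZ : Z.PosSemidef) (y : Fin n → ℝ) :
    S.stageCost R Q y (-(S.riccatiGain R Q Z *ᵥ y)) +
      S.surrogateStep Z y (-(S.riccatiGain R Q Z *ᵥ y)) = y ⬝ᵥ S.riccatiStep R Q Z *ᵥ y := by
  rw [S.stageCost_add_surrogateStep hR hQ hZ]
  simp

theorem surrogateStep_mono {Z' : Matrix (Fin n) (Fin n) ℝ}
    (h : ∀ y, y ⬝ᵥ Z *ᵥ y ≤ y ⬝ᵥ Z' *ᵥ y) (y : Fin n → ℝ) (u : Fin m → ℝ) :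
    S.surrogateStep Z y u ≤ S.surrogateStep Z' y u := by
  rw [surrogateStep, surrogateStep]
  refine add_le_add (h _) (Finset.sum_le_sum fun τ _ => ?_)
  rw [dotProduct_delayWeight, dotProduct_delayWeight]
  exact mul_le_mul_of_nonneg_left (h _) (sq_nonneg _)

theorem dotProduct_riccatiStep_mono (hR : R.PosDef) (hQ : Q.PosSemidef) (hZ : Z.PosSemidef)
    {Z' : Matrix (Fin n) (Fin n) ℝ} (hZ' : Z'.PosSemidef)
    (h : ∀ y, y ⬝ᵥ Z *ᵥ y ≤ y ⬝ᵥ Z' *ᵥ y) (y : Fin n → ℝ) :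
    y ⬝ᵥ S.riccatiStep R Q Z *ᵥ y ≤ y ⬝ᵥ S.riccatiStep R Q Z' *ᵥ y := by
  rw [← S.stageCost_add_surrogateStep_riccatiGain hR hQ hZ']
  exact (S.le_stageCost_add_surrogateStep hR hQ hZ y _).trans
    (add_le_add_right (S.surrogateStep_mono h y _) _)

theorem dotProduct_le_riccatiStep (hR : R.PosDef) (hQ : Q.PosSemidef) (hZ : Z.PosSemidef)
    (y : Fin n → ℝ) : y ⬝ᵥ Q *ᵥ y ≤ y ⬝ᵥ S.riccatiStep R Q Z *ᵥ y := by
  rw [← S.stageCost_add_surrogateStep_riccatiGain hR hQ hZ]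
  set u := -(S.riccatiGain R Q Z *ᵥ y)
  have h1 := (S.posDef_U hR hQ).posSemidef.dotProduct_nonneg u
  have h2 := S.surrogateStep_mono (Z := 0) (Z' := Z) (by simpa using hZ.dotProduct_nonneg) y u
  have h3 : S.surrogateStep 0 y u = 0 := by simp [surrogateStep, delayWeight]
  rw [stageCost]
  linarith

theorem posSemidef_riccatiStep (hR : R.PosDef) (hQ : Q.PosSemidef) (hZ : Z.PosSemidef) :
    (S.riccatiStep R Q Z).PosSemidef := by
  refine .of_isSymm ?_ fun y =>
    (hQ.dotProduct_nonneg y).trans (S.dotProduct_le_riccatiStep hR hQ hZ y)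
  rw [Matrix.IsSymm, riccatiStep]
  simp only [Matrix.transpose_sub, Matrix.transpose_add, Matrix.transpose_mul,
    Matrix.transpose_transpose, hZ.isSymm.eq, hQ.isSymm.eq, Matrix.transpose_nonsing_inv,
    (S.posDef_Ψ hR hQ hZ).posSemidef.isSymm.eq, Matrix.mul_assoc]

/-- Value iteration for the Riccati equation, started at `0`. -/
def riccatiIterate (R : Matrix (Fin m) (Fin m) ℝ) (Q : Matrix (Fin n) (Fin n) ℝ) (k : ℕ) :
    Matrix (Fin n) (Fin n) ℝ :=
  (S.riccatiStep R Q)^[k] 0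

theorem riccatiIterate_succ (k : ℕ) :
    S.riccatiIterate R Q (k + 1) = S.riccatiStep R Q (S.riccatiIterate R Q k) :=
  Function.iterate_succ_apply' _ _ _

theorem posSemidef_riccatiIterate (hR : R.PosDef) (hQ : Q.PosSemidef) (k : ℕ) :
    (S.riccatiIterate R Q k).PosSemidef := by
  induction k with
  | zero => exact Matrix.PosSemidef.zero
  | succ k ih =>
    rw [riccatiIterate_succ]
    exact S.posSemidef_riccatiStep hR hQ ih

theorem riccatiIterate_le_succ (hR : R.PosDef) (hQ : Q.PosSemidef) (k : ℕ) (y : Fin n → ℝ) :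
    y ⬝ᵥ S.riccatiIterate R Q k *ᵥ y ≤ y ⬝ᵥ S.riccatiIterate R Q (k + 1) *ᵥ y := by
  induction k generalizing y with
  | zero =>
    have : S.riccatiIterate R Q 0 = 0 := rfl
    rw [this]
    simpa using (S.posSemidef_riccatiIterate hR hQ 1).dotProduct_nonneg y
  | succ k ih =>
    rw [riccatiIterate_succ, riccatiIterate_succ S (k + 1)]
    exact S.dotProduct_riccatiStep_mono hR hQ (S.posSemidef_riccatiIterate hR hQ k)
      (S.posSemidef_riccatiIterate hR hQ (k + 1)) ih y

theorem continuous_Ψ : Continuous (S.Ψ R Q) := by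
  unfold Ψ
  fun_prop

theorem tendsto_riccatiStep {Zs : ℕ → Matrix (Fin n) (Fin n) ℝ}
    (hZs : Tendsto Zs atTop (𝓝 Z)) (hΨ : (S.Ψ R Q Z).det ≠ 0) :
    Tendsto (fun k => S.riccatiStep R Q (Zs k)) atTop (𝓝 (S.riccatiStep R Q Z)) := by
  have hlim := (S.continuous_Ψ (R := R) (Q := Q)).continuousAt.tendsto.comp hZs
  have hinv : Tendsto (fun k => (S.Ψ R Q (Zs k))⁻¹) atTop (𝓝 (S.Ψ R Q Z)⁻¹) := by
    have hdet : Tendsto (fun k => (S.Ψ R Q (Zs k)).det) atTop (𝓝 (S.Ψ R Q Z).det) :=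
      ((continuous_id.matrix_det).tendsto _).comp hlim
    have hadj : Tendsto (fun k => (S.Ψ R Q (Zs k)).adjugate) atTop (𝓝 (S.Ψ R Q Z).adjugate) :=
      ((continuous_id.matrix_adjugate).tendsto _).comp hlim
    simp only [Matrix.inv_def, Ring.inverse_eq_inv']
    exact (hdet.inv₀ hΨ).smul hadj
  have hc : Continuous fun p : Matrix (Fin n) (Fin n) ℝ × Matrix (Fin m) (Fin m) ℝ =>
      S.Aᵀ * p.1 * S.A + Q - S.Aᵀ * p.1 * S.L * p.2 * S.Lᵀ * p.1 * S.A := by fun_prop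
  have h := (hc.tendsto (Z, (S.Ψ R Q Z)⁻¹)).comp (hZs.prodMk_nhds hinv)
  exact h

/-- Bounded value iteration converges to a positive definite solution. -/
theorem exists_posDef_DDARE (hR : R.PosDef) (hQ : Q.PosDef)
    (hbdd : ∀ y, ∃ c, ∀ k, y ⬝ᵥ S.riccatiIterate R Q k *ᵥ y ≤ c) :
    ∃ Z : Matrix (Fin n) (Fin n) ℝ, Z.PosDef ∧ S.DDARE R Q Z := by
  have hQ' := hQ.posSemidef
  have hpsd := S.posSemidef_riccatiIterate hR hQ'
  have hquad : ∀ y, ∃ l, Tendsto (fun k => (S.riccatiIterate R Q k).quadForm y) atTop (𝓝 l) := by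
    intro y
    obtain ⟨c, hc⟩ := hbdd y
    simp only [Matrix.quadForm_apply]
    exact ⟨_, tendsto_atTop_ciSup
      (monotone_nat_of_le_succ fun k => S.riccatiIterate_le_succ hR hQ' k y)
      ⟨c, by rintro _ ⟨k, rfl⟩; exact hc k⟩⟩
  choose l hl using hquad
  let Z : Matrix (Fin n) (Fin n) ℝ := fun i j =>
    2⁻¹ * (l (Pi.single i 1 + Pi.single j 1) - l (Pi.single i 1) - l (Pi.single j 1))
  have hZ : Tendsto (S.riccatiIterate R Q) atTop (𝓝 Z) := by
    refine tendsto_pi_nhds.2 fun i => tendsto_pi_nhds.2 fun j => ?_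
    simp only [(hpsd _).isSymm.apply_eq_polar i j]
    exact (((hl _).sub (hl _)).sub (hl _)).const_mul _
  have hsymm : Z.IsSymm := by
    ext i j
    change 2⁻¹ * (l (Pi.single j 1 + Pi.single i 1) - l (Pi.single j 1) - l (Pi.single i 1)) =
      2⁻¹ * (l (Pi.single i 1 + Pi.single j 1) - l (Pi.single i 1) - l (Pi.single j 1))
    rw [add_comm (Pi.single j _)]
    ring
  have hlZ : ∀ y, Tendsto (fun k => y ⬝ᵥ S.riccatiIterate R Q k *ᵥ y) atTop (𝓝 (y ⬝ᵥ Z *ᵥ y)) := by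
    intro y
    have hc : Continuous fun M : Matrix (Fin n) (Fin n) ℝ => y ⬝ᵥ M *ᵥ y := by fun_prop
    exact hc.continuousAt.tendsto.comp hZ
  have hZpsd : Z.PosSemidef := .of_isSymm hsymm fun y =>
    ge_of_tendsto' (hlZ y) fun k => (hpsd k).dotProduct_nonneg y
  have hge : ∀ y, y ⬝ᵥ Q *ᵥ y ≤ y ⬝ᵥ Z *ᵥ y := by
    intro y
    refine ge_of_tendsto' ((hlZ y).comp (tendsto_add_atTop_nat 1)) fun k => ?_
    simp only [Function.comp_apply, riccatiIterate_succ]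
    exact S.dotProduct_le_riccatiStep hR hQ' (hpsd k) y
  refine ⟨Z, .of_dotProduct_mulVec_pos hZpsd.isHermitian fun y hy => ?_, ?_⟩
  · simpa using (hQ.dotProduct_pos hy).trans_le (hge y)
  · rw [DDARE_iff]
    refine tendsto_nhds_unique ?_ (hZ.comp (tendsto_add_atTop_nat 1))
    have hlim := S.tendsto_riccatiStep hZ (S.posDef_Ψ hR hQ' hZpsd).det_pos.ne'
    refine hlim.congr fun k => ?_
    rw [Function.comp_apply, riccatiIterate_succ]

end MultiDelaySystem

/-! ### Closed loops and mean-square stability -/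

namespace MultiDelaySystem

variable {n m D : ℕ} (S : MultiDelaySystem n m D)

/-- The linear law with gains `K₀, K`, as a linear function of the augmented state. -/
def gainInput (K₀ : Matrix (Fin m) (Fin n) ℝ) (K : Fin D → Matrix (Fin m) (Fin m) ℝ) :
    AugState n m D →ₗ[ℝ] (Fin m → ℝ) :=
  K₀.mulVecLin ∘ₗ LinearMap.fst ℝ _ _ +
    ∑ i, (K i).mulVecLin ∘ₗ LinearMap.proj i ∘ₗ LinearMap.snd ℝ _ _

theorem gainInput_apply (K₀ : Matrix (Fin m) (Fin n) ℝ) (K : Fin D → Matrix (Fin m) (Fin m) ℝ)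
    (ξ : AugState n m D) : gainInput K₀ K ξ = linearLaw K₀ K ξ.1 ξ.2 := by
  simp [gainInput, linearLaw]

/-- The squared Euclidean norm of the augmented state. -/
def augNormSq (n m D : ℕ) : QuadraticForm ℝ (AugState n m D) :=
  (1 : Matrix (Fin n) (Fin n) ℝ).quadForm.comp (LinearMap.fst ℝ _ _) +
    ∑ i, (1 : Matrix (Fin m) (Fin m) ℝ).quadForm.comp (LinearMap.proj i ∘ₗ LinearMap.snd ℝ _ _)

theorem augNormSq_apply (ξ : AugState n m D) :
    augNormSq n m D ξ = ξ.1 ⬝ᵥ ξ.1 + ∑ i, ξ.2 i ⬝ᵥ ξ.2 i := by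
  simp [augNormSq, Matrix.quadForm_apply]

theorem norm_sq_le_dotProduct_self {k : ℕ} (v : Fin k → ℝ) : ‖v‖ ^ 2 ≤ v ⬝ᵥ v := by
  have h0 : 0 ≤ v ⬝ᵥ v := Finset.sum_nonneg fun _ _ => mul_self_nonneg _
  rw [← Real.le_sqrt (norm_nonneg _) h0, pi_norm_le_iff_of_nonneg (Real.sqrt_nonneg _)]
  intro i
  rw [Real.norm_eq_abs]
  refine Real.abs_le_sqrt ?_
  rw [sq]
  exact Finset.single_le_sum (f := fun i => v i * v i) (fun _ _ => mul_self_nonneg _)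
    (Finset.mem_univ i)

theorem dotProduct_self_nonneg_real {k : ℕ} (v : Fin k → ℝ) : 0 ≤ v ⬝ᵥ v :=
  Finset.sum_nonneg fun _ _ => mul_self_nonneg _

theorem norm_sq_le_augNormSq (ξ : AugState n m D) : ‖ξ‖ ^ 2 ≤ augNormSq n m D ξ := by
  have h0 : 0 ≤ augNormSq n m D ξ := by
    rw [augNormSq_apply]
    exact add_nonneg (dotProduct_self_nonneg_real _)
      (Finset.sum_nonneg fun _ _ => dotProduct_self_nonneg_real _)
  have hsum := Finset.sum_nonneg fun i (_ : i ∈ (Finset.univ : Finset (Fin D))) =>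
    dotProduct_self_nonneg_real (ξ.2 i)
  rw [← Real.le_sqrt (norm_nonneg _) h0, Prod.norm_def, max_le_iff,
    pi_norm_le_iff_of_nonneg (x := ξ.2) (Real.sqrt_nonneg _)]
  refine ⟨Real.le_sqrt_of_sq_le ?_, fun i => Real.le_sqrt_of_sq_le ?_⟩
  · rw [augNormSq_apply]
    linarith [norm_sq_le_dotProduct_self ξ.1]
  · have h1 := Finset.single_le_sum (f := fun i => ξ.2 i ⬝ᵥ ξ.2 i)
      (fun _ _ => dotProduct_self_nonneg_real _) (Finset.mem_univ i)
    rw [augNormSq_apply]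
    linarith [norm_sq_le_dotProduct_self (ξ.2 i), dotProduct_self_nonneg_real ξ.1]

/-- The closed loop with input `v` is mean-square stable: the second moment of the augmented state
tends to `0` from every initial value. -/
def IsMeanSquareStable (v : AugState n m D →ₗ[ℝ] (Fin m → ℝ)) : Prop :=
  ∀ ξ, Tendsto (fun t => (momentOperator S.σ (S.drift v) (S.diffusion v) ^ t)
    (augNormSq n m D) ξ) atTop (𝓝 0)

section ClosedLoop

variable {Ω : Type*} {ω : ℕ → Ω → Fin (D + 1) → ℝ} {K₀ : Matrix (Fin m) (Fin n) ℝ}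
  {K : Fin D → Matrix (Fin m) (Fin m) ℝ} {x₀ : Fin n → ℝ} {ψ : Fin D → Fin m → ℝ}
  {x : ℕ → Ω → Fin n → ℝ} {u : ℤ → Ω → Fin m → ℝ}

/-- The augmented state along a trajectory. -/
def augTrajectory (D : ℕ) (x : ℕ → Ω → Fin n → ℝ) (u : ℤ → Ω → Fin m → ℝ) (t : ℕ) (w : Ω) :
    AugState n m D :=
  (x t w, fun i => u ((t : ℤ) - ((i : ℤ) + 1)) w)

variable {S}

theorem IsClosedLoop.inputHistory_eq (h : S.IsClosedLoop ω (linearLaw K₀ K) x₀ ψ x u) (t : ℕ)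
    (w : Ω) (τ : Fin (D + 1)) :
    inputHistory (gainInput K₀ K) τ (augTrajectory D x u t w) = u ((t : ℤ) - (τ : ℤ)) w := by
  induction τ using Fin.cases with
  | zero =>
    rw [inputHistory_zero, gainInput_apply]
    simpa [augTrajectory] using (h.feedback t w).symm
  | succ i =>
    rw [inputHistory_succ]
    simp [augTrajectory]

theorem IsClosedLoop.augTrajectory_zero (h : S.IsClosedLoop ω (linearLaw K₀ K) x₀ ψ x u) (w : Ω) :
    augTrajectory D x u 0 w = (x₀, ψ) := by
  refine Prod.ext (h.init_state w) (funext fun i => ?_)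
  simpa [augTrajectory] using h.init_input i w

theorem IsClosedLoop.augTrajectory_succ (h : S.IsClosedLoop ω (linearLaw K₀ K) x₀ ψ x u) (t : ℕ)
    (w : Ω) : augTrajectory D x u (t + 1) w =
      S.drift (gainInput K₀ K) (augTrajectory D x u t w) +
        ∑ τ, ω t w τ • S.diffusion (gainInput K₀ K) τ (augTrajectory D x u t w) := by
  refine Prod.ext ?_ (funext fun i => ?_)
  · rw [Prod.fst_add, Prod.fst_sum, drift_fst]
    simp only [Prod.smul_fst, diffusion_fst, h.inputHistory_eq]
    simp only [augTrajectory, h.dynamics, Matrix.add_mulVec, Finset.sum_add_distrib, add_assoc,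
      Matrix.smul_mulVec]
  · rw [Prod.snd_add, Prod.snd_sum, Pi.add_apply, drift_snd, h.inputHistory_eq]
    simp [augTrajectory, diffusion_snd]

variable (S)

/-- The augmented state of the closed loop with input `v`, from the initial value `ξ₀`. -/
def augSolution (v : AugState n m D →ₗ[ℝ] (Fin m → ℝ)) (ω : ℕ → Ω → Fin (D + 1) → ℝ)
    (ξ₀ : AugState n m D) : ℕ → Ω → AugState n m D
  | 0, _ => ξ₀
  | t + 1, w => S.drift v (augSolution v ω ξ₀ t w) +
      ∑ τ, ω t w τ • S.diffusion v τ (augSolution v ω ξ₀ t w)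

/-- The input of the closed loop with input `v`, continued by `0` to the times before `-D`. -/
def inputSolution (v : AugState n m D →ₗ[ℝ] (Fin m → ℝ)) (ω : ℕ → Ω → Fin (D + 1) → ℝ)
    (ξ₀ : AugState n m D) : ℤ → Ω → Fin m → ℝ
  | Int.ofNat t, w => v (S.augSolution v ω ξ₀ t w)
  | Int.negSucc s, _ => if h : s < D then ξ₀.2 ⟨s, h⟩ else 0

theorem inputHistory_augSolution (v : AugState n m D →ₗ[ℝ] (Fin m → ℝ)) (ξ₀ : AugState n m D)
    (t : ℕ) (w : Ω) (τ : Fin (D + 1)) :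
    inputHistory v τ (S.augSolution v ω ξ₀ t w) =
      S.inputSolution v ω ξ₀ ((t : ℤ) - (τ : ℤ)) w := by
  induction t generalizing τ with
  | zero =>
    induction τ using Fin.cases with
    | zero => rfl
    | succ i =>
      have hi : ((0 : ℕ) : ℤ) - ((i.succ : Fin (D + 1)) : ℕ) = Int.negSucc i := by
        rw [Int.negSucc_eq]
        simp
      rw [hi]
      simp [inputSolution, augSolution]
  | succ t ih =>
    induction τ using Fin.cases with
    | zero => rw [Fin.val_zero, Nat.cast_zero, sub_zero]; rfl
    | succ i =>
      have hi : ((t + 1 : ℕ) : ℤ) - ((i.succ : Fin (D + 1)) : ℕ) =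
          (t : ℤ) - ((i.castSucc : Fin (D + 1)) : ℕ) := by
        simp
      rw [hi, ← ih, inputHistory_succ, augSolution, Prod.snd_add, Prod.snd_sum, Pi.add_apply,
        drift_snd]
      simp [diffusion_snd]

theorem isClosedLoop_augSolution (x₀ : Fin n → ℝ) (ψ : Fin D → Fin m → ℝ) :
    S.IsClosedLoop ω (linearLaw K₀ K) x₀ ψ
      (fun t w => (S.augSolution (gainInput K₀ K) ω (x₀, ψ) t w).1)
      (S.inputSolution (gainInput K₀ K) ω (x₀, ψ)) where
  init_state w := rfl
  init_input i w := by
    have hi : -((i : ℤ) + 1) = Int.negSucc i := by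
      rw [Int.negSucc_eq]
    rw [hi]
    simp [inputSolution]
  dynamics t w := by
    rw [augSolution, Prod.fst_add, Prod.fst_sum, drift_fst]
    simp only [Prod.smul_fst, diffusion_fst, ← inputHistory_augSolution, Matrix.add_mulVec,
      Finset.sum_add_distrib, add_assoc, Matrix.smul_mulVec]
  feedback t w := by
    have h : S.inputSolution (gainInput K₀ K) ω (x₀, ψ) (t : ℤ) w =
        gainInput K₀ K (S.augSolution (gainInput K₀ K) ω (x₀, ψ) t w) := rfl
    rw [h, gainInput_apply]
    congr 1
    funext i
    have := S.inputHistory_augSolution (ω := ω) (gainInput K₀ K) (x₀, ψ) t w i.succ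
    rw [inputHistory_succ] at this
    rw [this]
    simp

/-- Admissibility of a linear law only depends on the second moments. Convergence of the second
moments makes the inputs square summable because it is automatically exponential. -/
theorem isStabilizedBy_linearLaw_iff [MeasurableSpace Ω] {μ : Measure Ω} [IsProbabilityMeasure μ]
    (hω : IsMultiplicativeNoise μ S.σ ω) :
    S.IsStabilizedBy μ ω (linearLaw K₀ K) ↔ S.IsMeanSquareStable (gainInput K₀ K) := by
  constructor
  · rintro ⟨-, hstab⟩ ⟨x₀, ψ⟩
    obtain ⟨x, u, hcl, -, hui, husum, hxi, hx⟩ := hstab x₀ ψ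
    have hint := integral_quadraticForm hω hcl.augTrajectory_zero hcl.augTrajectory_succ
      (augNormSq n m D)
    have hLp := memLp_randomRecursion hω hcl.augTrajectory_zero hcl.augTrajectory_succ
    have hpi : ∀ (i : Fin D) (t : ℕ), Integrable (fun w => u ((t : ℤ) - ((i : ℤ) + 1)) w ⬝ᵥ
        u ((t : ℤ) - ((i : ℤ) + 1)) w) μ := by
      intro i t
      have := QuadraticForm.integrable_comp_of_memLp
        ((1 : Matrix (Fin m) (Fin m) ℝ).quadForm.comp ((LinearMap.proj i :
          (Fin D → Fin m → ℝ) →ₗ[ℝ] _) ∘ₗ LinearMap.snd ℝ (Fin n → ℝ) _)) (hLp t)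
      simpa [Matrix.quadForm_apply, augTrajectory] using this
    have hlim : ∀ i : Fin D, Tendsto (fun t : ℕ => ∫ w, u ((t : ℤ) - ((i : ℤ) + 1)) w ⬝ᵥ
        u ((t : ℤ) - ((i : ℤ) + 1)) w ∂μ) atTop (𝓝 0) := by
      intro i
      rw [← tendsto_add_atTop_iff_nat ((i : ℕ) + 1)]
      refine husum.tendsto_atTop_zero.congr fun t => ?_
      have : ((t + ((i : ℕ) + 1) : ℕ) : ℤ) - ((i : ℤ) + 1) = t := by push_cast; ring
      rw [this]
    have htot := hx.add (tendsto_finsetSum Finset.univ fun i _ => hlim i)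
    simp only [Finset.sum_const_zero, add_zero] at htot
    refine htot.congr fun t => ?_
    rw [← hint t]
    simp only [augNormSq_apply, augTrajectory]
    rw [integral_add (hxi t) (integrable_finsetSum _ fun i _ => hpi i t),
      integral_finsetSum _ fun i _ => hpi i t]
  · intro hst
    refine ⟨⟨K₀, K, rfl⟩, fun x₀ ψ => ⟨_, _, S.isClosedLoop_augSolution x₀ ψ, ?_⟩⟩
    have h0 : ∀ w, S.augSolution (gainInput K₀ K) ω (x₀, ψ) 0 w = (x₀, ψ) := fun _ => rfl
    have hs : ∀ t w, S.augSolution (gainInput K₀ K) ω (x₀, ψ) (t + 1) w = _ := fun _ _ => rfl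
    have hLp := memLp_randomRecursion hω h0 hs
    let qu : QuadraticForm ℝ (AugState n m D) :=
      (1 : Matrix (Fin m) (Fin m) ℝ).quadForm.comp (gainInput K₀ K)
    let qx : QuadraticForm ℝ (AugState n m D) :=
      (1 : Matrix (Fin n) (Fin n) ℝ).quadForm.comp (LinearMap.fst ℝ _ _)
    have hqu : ∀ (t : ℕ) w, S.inputSolution (gainInput K₀ K) ω (x₀, ψ) (t : ℤ) w ⬝ᵥ
        S.inputSolution (gainInput K₀ K) ω (x₀, ψ) (t : ℤ) w =
        qu (S.augSolution (gainInput K₀ K) ω (x₀, ψ) t w) := by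
      intro t w
      simp only [qu, QuadraticMap.comp_apply, Matrix.quadForm_apply, Matrix.one_mulVec]
      rfl
    have hqx : ∀ ξ : AugState n m D, ξ.1 ⬝ᵥ ξ.1 = qx ξ := by
      intro ξ
      simp [qx, Matrix.quadForm_apply]
    have hqu0 : ∀ ξ, 0 ≤ qu ξ := fun ξ => by
      simpa [qu, Matrix.quadForm_apply] using dotProduct_self_nonneg_real _
    have hqx0 : ∀ ξ, 0 ≤ qx ξ := fun ξ => by
      simpa [qx, Matrix.quadForm_apply] using dotProduct_self_nonneg_real _
    simp only [hqu, hqx, integral_quadraticForm hω h0 hs]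
    refine ⟨fun t => ?_, fun t => qu.integrable_comp_of_memLp (hLp t), ?_,
      fun t => qx.integrable_comp_of_memLp (hLp t), ?_⟩
    · exact (gainInput K₀ K).continuous_of_finiteDimensional.measurable.comp
        (measurable_noisePast h0 hs t)
    · obtain ⟨c, hc⟩ := exists_sum_momentOperator_pow_le norm_sq_le_augNormSq hst qu (x₀, ψ)
      exact summable_of_sum_range_le (fun t => momentOperator_pow_nonneg hqu0 t _) hc
    · exact tendsto_momentOperator_pow norm_sq_le_augNormSq (hst _) hqx0

end ClosedLoop

end MultiDelaySystem

/-! ### Solving the Riccati equation and stabilizing the system -/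

namespace MultiDelaySystem

variable {n m D : ℕ} (S : MultiDelaySystem n m D)
  {R : Matrix (Fin m) (Fin m) ℝ} {Q Z : Matrix (Fin n) (Fin n) ℝ}

/-- The stage cost as a quadratic form of the augmented state, for the closed loop with
input `v`. -/
def stageForm (R : Matrix (Fin m) (Fin m) ℝ) (Q : Matrix (Fin n) (Fin n) ℝ)
    (v : AugState n m D →ₗ[ℝ] (Fin m → ℝ)) : QuadraticForm ℝ (AugState n m D) :=
  Q.quadForm.comp S.predictor + (S.U R Q).quadForm.comp v

theorem stageForm_apply (v : AugState n m D →ₗ[ℝ] (Fin m → ℝ)) (ξ : AugState n m D) :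
    S.stageForm R Q v ξ = S.stageCost R Q (S.predictor ξ) (v ξ) := by
  simp [stageForm, stageCost, Matrix.quadForm_apply]

/-- The predictor feedback `u = -Ψ⁻¹ L' Z A y`. -/
def riccatiInput (R : Matrix (Fin m) (Fin m) ℝ) (Q Z : Matrix (Fin n) (Fin n) ℝ) :
    AugState n m D →ₗ[ℝ] (Fin m → ℝ) :=
  -((S.riccatiGain R Q Z).mulVecLin ∘ₗ S.predictor)

theorem riccatiInput_apply (ξ : AugState n m D) :
    S.riccatiInput R Q Z ξ = -(S.riccatiGain R Q Z *ᵥ S.predictor ξ) := rfl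

theorem momentOperator_storage_riccatiInput (hR : R.PosDef) (hQ : Q.PosSemidef)
    (hZ : Z.PosSemidef) (hric : S.DDARE R Q Z) (ξ : AugState n m D) :
    momentOperator S.σ (S.drift (S.riccatiInput R Q Z)) (S.diffusion (S.riccatiInput R Q Z))
      (S.storage Z) ξ + S.stageForm R Q (S.riccatiInput R Q Z) ξ = S.storage Z ξ := by
  have h := S.stageCost_add_surrogateStep_riccatiGain hR hQ hZ (S.predictor ξ)
  rw [S.DDARE_iff.1 hric] at h
  rw [momentOperator_storage, stageForm_apply, riccatiInput_apply]
  linarith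

theorem storage_le_momentOperator_storage (hR : R.PosDef) (hQ : Q.PosSemidef)
    (hZ : Z.PosSemidef) (hle : ∀ y, y ⬝ᵥ Z *ᵥ y ≤ y ⬝ᵥ S.riccatiStep R Q Z *ᵥ y)
    (v : AugState n m D →ₗ[ℝ] (Fin m → ℝ)) (ξ : AugState n m D) :
    S.storage Z ξ ≤ momentOperator S.σ (S.drift v) (S.diffusion v) (S.storage Z) ξ +
      S.stageForm R Q v ξ := by
  have h := S.le_stageCost_add_surrogateStep hR hQ hZ (S.predictor ξ) (v ξ)
  rw [momentOperator_storage, stageForm_apply]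
  linarith [hle (S.predictor ξ)]

theorem stageForm_nonneg (hR : R.PosDef) (hQ : Q.PosSemidef)
    (v : AugState n m D →ₗ[ℝ] (Fin m → ℝ)) (ξ : AugState n m D) : 0 ≤ S.stageForm R Q v ξ := by
  rw [stageForm_apply]
  exact add_nonneg (hQ.dotProduct_nonneg _) ((S.posDef_U hR hQ).posSemidef.dotProduct_nonneg _)

/-- A positive definite matrix dominates the identity up to a constant. -/
theorem exists_dotProduct_self_le_mul {k : ℕ} {M : Matrix (Fin k) (Fin k) ℝ} (hM : M.PosDef) :
    ∃ C : ℝ, 0 ≤ C ∧ ∀ v, v ⬝ᵥ v ≤ C * (v ⬝ᵥ M *ᵥ v) := by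
  obtain ⟨C, hC0, hC⟩ := M.quadForm.exists_norm_sq_le_mul_of_pos fun v hv => by
    rw [Matrix.quadForm_apply]
    exact hM.dotProduct_pos hv
  obtain ⟨C', hC0', hC'⟩ := (1 : Matrix (Fin k) (Fin k) ℝ).quadForm.exists_abs_le_mul_norm_sq
  refine ⟨C' * C, mul_nonneg hC0' hC0, fun v => ?_⟩
  have h1 := (le_abs_self _).trans (hC' v)
  have h2 := mul_le_mul_of_nonneg_left (hC v) hC0'
  rw [Matrix.quadForm_apply] at h1 h2
  rw [Matrix.one_mulVec] at h1
  linarith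

/-- The augmented state is determined by the predictor and the past inputs. -/
theorem eq_zero_of_predictor_eq_zero (hA : IsUnit S.A) {ξ : AugState n m D}
    (h : S.predictor ξ = 0) (h2 : ξ.2 = 0) : ξ = 0 := by
  refine Prod.ext ?_ h2
  rw [predictor_apply, h2] at h
  simp only [Pi.zero_apply, Matrix.mulVec_zero, Finset.sum_const_zero, add_zero] at h
  exact (Matrix.mulVec_injective_iff_isUnit.2 (hA.pow D)) (by simpa using h)

/-- If the accumulated stage cost is finite, the input and the predictor are square summable,
hence tend to `0` in mean square; so do the past inputs, which are shifts of the current one, and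
with them the state, which the predictor and the past inputs determine. -/
theorem isMeanSquareStable_of_sum_le (hA : IsUnit S.A) (hR : R.PosDef) (hQ : Q.PosDef)
    (v : AugState n m D →ₗ[ℝ] (Fin m → ℝ))
    (hsum : ∀ ξ, ∃ c, ∀ N, ∑ t ∈ Finset.range N,
      (momentOperator S.σ (S.drift v) (S.diffusion v) ^ t) (S.stageForm R Q v) ξ ≤ c) :
    S.IsMeanSquareStable v := by
  intro ξ
  set T := momentOperator S.σ (S.drift v) (S.diffusion v) with hT
  have hQ' := hQ.posSemidef
  have hW : Tendsto (fun t => (T ^ t) (S.stageForm R Q v) ξ) atTop (𝓝 0) := by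
    obtain ⟨c, hc⟩ := hsum ξ
    exact (summable_of_sum_range_le
      (fun t => momentOperator_pow_nonneg (S.stageForm_nonneg hR hQ' v) t ξ)
      hc).tendsto_atTop_zero
  have hdom : ∀ {q : QuadraticForm ℝ (AugState n m D)} {p : QuadraticForm ℝ (AugState n m D)}
      {C : ℝ}, (∀ ξ, 0 ≤ q ξ) → (∀ ξ, q ξ ≤ C * p ξ) →
      Tendsto (fun t => (T ^ t) p ξ) atTop (𝓝 0) → Tendsto (fun t => (T ^ t) q ξ) atTop (𝓝 0) := by
    intro q p C hq hqp hp
    have hlim := hp.const_mul C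
    rw [mul_zero] at hlim
    exact squeeze_zero (fun t => momentOperator_pow_nonneg hq t ξ)
      (fun t => momentOperator_pow_le_of_le_mul hqp t ξ) hlim
  let qu : Fin (D + 1) → QuadraticForm ℝ (AugState n m D) := fun τ =>
    (1 : Matrix (Fin m) (Fin m) ℝ).quadForm.comp (inputHistory v τ)
  have hqu : ∀ τ ξ, qu τ ξ = inputHistory v τ ξ ⬝ᵥ inputHistory v τ ξ := fun τ ξ => by
    simp [qu, Matrix.quadForm_apply]
  have hulim : ∀ τ, Tendsto (fun t => (T ^ t) (qu τ) ξ) atTop (𝓝 0) := by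
    intro τ
    induction τ using Fin.induction with
    | zero =>
      obtain ⟨C, hC0, hC⟩ := exists_dotProduct_self_le_mul (S.posDef_U hR hQ')
      refine hdom (C := C) (fun ξ => ?_) (fun ξ => ?_) hW
      · rw [hqu]
        exact dotProduct_self_nonneg_real _
      · rw [hqu, stageForm_apply, inputHistory_zero, stageCost]
        refine (hC _).trans (mul_le_mul_of_nonneg_left ?_ hC0)
        linarith [hQ'.dotProduct_nonneg (S.predictor ξ)]
    | succ i ih =>
      -- One step later, the input with lag `i` is the input with lag `i + 1`.
      have hstep : T (qu i.succ) = qu i.castSucc := by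
        ext ζ
        rw [hT, momentOperator_apply]
        simp only [hqu, inputHistory_succ, drift_snd, diffusion_snd]
        simp
      rw [← tendsto_add_atTop_iff_nat 1]
      simpa only [pow_succ, Module.End.mul_apply, hstep] using ih
  let qy : QuadraticForm ℝ (AugState n m D) :=
    (1 : Matrix (Fin n) (Fin n) ℝ).quadForm.comp S.predictor
  have hqy : ∀ ξ, qy ξ = S.predictor ξ ⬝ᵥ S.predictor ξ := fun ξ => by
    simp [qy, Matrix.quadForm_apply]
  have hylim : Tendsto (fun t => (T ^ t) qy ξ) atTop (𝓝 0) := by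
    obtain ⟨C, hC0, hC⟩ := exists_dotProduct_self_le_mul hQ
    refine hdom (C := C) (fun ξ => ?_) (fun ξ => ?_) hW
    · rw [hqy]
      exact dotProduct_self_nonneg_real _
    · rw [hqy, stageForm_apply, stageCost]
      refine (hC _).trans (mul_le_mul_of_nonneg_left ?_ hC0)
      linarith [(S.posDef_U hR hQ').posSemidef.dotProduct_nonneg (v ξ)]
  have hplim : Tendsto (fun t => (T ^ t) (qy + ∑ i : Fin D, qu i.succ) ξ) atTop (𝓝 0) := by
    have := hylim.add (tendsto_finsetSum Finset.univ fun (i : Fin D) _ => hulim i.succ)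
    simpa using this
  obtain ⟨C, hC0, hC⟩ := (qy + ∑ i : Fin D, qu i.succ).exists_norm_sq_le_mul_of_pos fun ζ hζ => by
    have hy0 := dotProduct_self_nonneg_real (S.predictor ζ)
    have hu0 := Finset.sum_nonneg fun i (_ : i ∈ (Finset.univ : Finset (Fin D))) =>
      dotProduct_self_nonneg_real (ζ.2 i)
    have hval : (qy + ∑ i : Fin D, qu i.succ) ζ =
        S.predictor ζ ⬝ᵥ S.predictor ζ + ∑ i, ζ.2 i ⬝ᵥ ζ.2 i := by
      simp [hqy, hqu]
    rw [hval]
    refine (add_nonneg hy0 hu0).lt_of_ne fun h => hζ ?_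
    have h1 : S.predictor ζ ⬝ᵥ S.predictor ζ = 0 := by linarith
    have h2 : ∑ i, ζ.2 i ⬝ᵥ ζ.2 i = 0 := by linarith
    rw [Finset.sum_eq_zero_iff_of_nonneg fun i _ => dotProduct_self_nonneg_real _] at h2
    exact S.eq_zero_of_predictor_eq_zero hA (dotProduct_self_eq_zero.1 h1)
      (funext fun i => dotProduct_self_eq_zero.1 (h2 i (Finset.mem_univ i)))
  obtain ⟨C', hC0', hC'⟩ := (augNormSq n m D).exists_abs_le_mul_norm_sq
  refine hdom (C := C' * C) (fun ξ => (sq_nonneg _).trans (norm_sq_le_augNormSq ξ))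
    (fun ζ => ?_) hplim
  rw [mul_assoc]
  exact ((le_abs_self _).trans (hC' ζ)).trans (mul_le_mul_of_nonneg_left (hC ζ) hC0')

theorem isMeanSquareStable_riccatiInput (hA : IsUnit S.A) (hR : R.PosDef) (hQ : Q.PosDef)
    (hZ : Z.PosSemidef) (hric : S.DDARE R Q Z) :
    S.IsMeanSquareStable (S.riccatiInput R Q Z) :=
  S.isMeanSquareStable_of_sum_le hA hR hQ _ fun ξ => ⟨S.storage Z ξ, fun N =>
    sum_momentOperator_pow_le
      (fun ζ => (S.momentOperator_storage_riccatiInput hR hQ.posSemidef hZ hric ζ).le)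
      (fun ζ => S.storage_nonneg ζ hZ.dotProduct_nonneg) N ξ⟩

/-- The predictor attains every value, with zero past inputs; there the storage function is
the quadratic form of `Z`. -/
theorem exists_predictor_eq (hA : IsUnit S.A) (y : Fin n → ℝ) :
    ∃ ξ : AugState n m D, ∀ Z, S.storage Z ξ = y ⬝ᵥ Z *ᵥ y := by
  have hu : IsUnit (S.A ^ D).det := (Matrix.isUnit_iff_isUnit_det _).1 (hA.pow D)
  refine ⟨((S.A ^ D)⁻¹ *ᵥ y, 0), fun Z => ?_⟩
  rw [storage_apply, predictor_apply]
  simp [Matrix.mulVec_mulVec, Matrix.mul_nonsing_inv _ hu]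

/-- A stabilizing input bounds the value iteration by its own total cost. -/
theorem riccatiIterate_bounded (hA : IsUnit S.A) (hR : R.PosDef) (hQ : Q.PosSemidef)
    {v : AugState n m D →ₗ[ℝ] (Fin m → ℝ)} (hv : S.IsMeanSquareStable v) (y : Fin n → ℝ) :
    ∃ c, ∀ k, y ⬝ᵥ S.riccatiIterate R Q k *ᵥ y ≤ c := by
  obtain ⟨ξ, hξ⟩ := S.exists_predictor_eq hA y
  obtain ⟨c, hc⟩ := exists_sum_momentOperator_pow_le norm_sq_le_augNormSq hv (S.stageForm R Q v) ξ
  refine ⟨c, fun k => ?_⟩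
  have hpsd := S.posSemidef_riccatiIterate hR hQ k
  rw [← hξ]
  refine le_of_sum_momentOperator_pow_le
    (S.storage_le_momentOperator_storage hR hQ hpsd (fun z => ?_) v) ξ
    (tendsto_momentOperator_pow norm_sq_le_augNormSq (hv ξ)
      fun ζ => S.storage_nonneg ζ hpsd.dotProduct_nonneg) hc
  rw [← riccatiIterate_succ]
  exact S.riccatiIterate_le_succ hR hQ k z

/-- The total cost of the closed loop of `Z` is at most the storage function of `Z`, and at least
that of any other solution `Z'`. -/
theorem dotProduct_le_of_DDARE (hA : IsUnit S.A) (hR : R.PosDef) (hQ : Q.PosDef)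
    {Z' : Matrix (Fin n) (Fin n) ℝ} (hZ : Z.PosSemidef) (hZ' : Z'.PosSemidef)
    (h : S.DDARE R Q Z) (h' : S.DDARE R Q Z') (y : Fin n → ℝ) :
    y ⬝ᵥ Z' *ᵥ y ≤ y ⬝ᵥ Z *ᵥ y := by
  obtain ⟨ξ, hξ⟩ := S.exists_predictor_eq hA y
  have hQ' := hQ.posSemidef
  rw [← hξ, ← hξ]
  exact le_of_sum_momentOperator_pow_le
    (S.storage_le_momentOperator_storage hR hQ' hZ'
      (fun z => by rw [S.DDARE_iff.1 h']) (S.riccatiInput R Q Z)) ξ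
    (tendsto_momentOperator_pow norm_sq_le_augNormSq
      (S.isMeanSquareStable_riccatiInput hA hR hQ hZ h ξ)
      fun ζ => S.storage_nonneg ζ hZ'.dotProduct_nonneg)
    fun N => sum_momentOperator_pow_le
      (fun ζ => (S.momentOperator_storage_riccatiInput hR hQ' hZ h ζ).le)
      (fun ζ => S.storage_nonneg ζ hZ.dotProduct_nonneg) N ξ

theorem DDARE_unique (hA : IsUnit S.A) (hR : R.PosDef) (hQ : Q.PosDef)
    {Z' : Matrix (Fin n) (Fin n) ℝ} (hZ : Z.PosSemidef) (hZ' : Z'.PosSemidef)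
    (h : S.DDARE R Q Z) (h' : S.DDARE R Q Z') : Z' = Z := by
  have hq : ∀ y, Z'.quadForm y = Z.quadForm y := fun y => by
    rw [Matrix.quadForm_apply, Matrix.quadForm_apply]
    exact le_antisymm (S.dotProduct_le_of_DDARE hA hR hQ hZ hZ' h h' y)
      (S.dotProduct_le_of_DDARE hA hR hQ hZ' hZ h' h y)
  ext i j
  rw [hZ'.isSymm.apply_eq_polar, hZ.isSymm.apply_eq_polar, hq, hq, hq]

theorem existsUnique_DDARE (hA : IsUnit S.A) (hR : R.PosDef) (hQ : Q.PosDef)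
    {v : AugState n m D →ₗ[ℝ] (Fin m → ℝ)} (hv : S.IsMeanSquareStable v) :
    ∃! Z : Matrix (Fin n) (Fin n) ℝ, Z.PosDef ∧ S.DDARE R Q Z := by
  obtain ⟨Z, hZ, hric⟩ :=
    S.exists_posDef_DDARE hR hQ (S.riccatiIterate_bounded hA hR hQ.posSemidef hv)
  exact ⟨Z, ⟨hZ, hric⟩, fun Z' h =>
    S.DDARE_unique hA hR hQ hZ.posSemidef h.1.posSemidef hric h.2⟩

/-- `riccatiLaw` is linear with constant gains, and it is the predictor feedback. -/
theorem exists_riccatiLaw_eq_linearLaw (hA : IsUnit S.A) :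
    ∃ (K₀ : Matrix (Fin m) (Fin n) ℝ) (K : Fin D → Matrix (Fin m) (Fin m) ℝ),
      S.riccatiLaw R Q Z = linearLaw K₀ K ∧ gainInput K₀ K = S.riccatiInput R Q Z := by
  have hdet : IsUnit S.A.det := (Matrix.isUnit_iff_isUnit_det _).1 hA
  let P : Matrix (Fin m) (Fin n) ℝ := (S.Ψ R Q Z)⁻¹ * S.Lᵀ * Z * S.A ^ D
  let K₀ := -(P * S.A)
  let K : Fin D → Matrix (Fin m) (Fin m) ℝ := fun i =>
    -(P * ∑ j ∈ Finset.Ici i.succ, S.A ^ (((i : ℤ) + 1) - (j : ℤ)) * S.B j)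
  have hlaw : S.riccatiLaw R Q Z = linearLaw K₀ K := by
    funext x p
    simp only [riccatiLaw, linearLaw, K₀, K, P, Matrix.neg_mulVec, Finset.sum_neg_distrib,
      ← neg_add, Matrix.mulVec_add, Matrix.mulVec_sum, ← Matrix.mulVec_mulVec, Matrix.sum_mulVec]
  have hpow : ∀ (i : Fin D) (j : Fin (D + 1)),
      S.A ^ D * S.A ^ (((i : ℤ) + 1) - (j : ℤ)) = S.A * S.A ^ (D + i - j) := by
    intro i j
    have hj := j.is_le
    rw [← zpow_natCast, ← Matrix.zpow_add hdet, ← pow_succ', ← zpow_natCast]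
    congr 1
    omega
  refine ⟨K₀, K, hlaw, LinearMap.ext fun ξ => ?_⟩
  rw [gainInput_apply, ← hlaw, riccatiInput_apply, predictor_apply, riccatiLaw]
  congr 1
  have hA' : S.A ^ D * S.A = S.A * S.A ^ D := by rw [← pow_succ, pow_succ']
  rw [riccatiGain, ← Matrix.mulVec_mulVec _ _ (S.A ^ D), ← Matrix.mulVec_mulVec _ _ S.A]
  congr 1
  rw [Matrix.mulVec_add, Matrix.mulVec_add, Matrix.mulVec_mulVec, Matrix.mulVec_mulVec, hA']
  congr 1
  simp only [Matrix.mulVec_sum, Matrix.mulVec_mulVec, ← Matrix.mul_assoc, hpow]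

end MultiDelaySystem

end

theorem theorem1 {n m D : ℕ} (S : MultiDelaySystem n m D) (hA : IsUnit S.A)
    {Ω : Type*} [MeasurableSpace Ω] (μ : Measure Ω) [IsProbabilityMeasure μ]
    (ω : ℕ → Ω → Fin (D + 1) → ℝ) (hω : IsMultiplicativeNoise μ S.σ ω) :
    (S.IsStabilizable μ ω ↔
      ∀ (Q : Matrix (Fin n) (Fin n) ℝ) (R : Matrix (Fin m) (Fin m) ℝ), Q.PosDef → R.PosDef →
        ∃! Z : Matrix (Fin n) (Fin n) ℝ, Z.PosDef ∧ S.DDARE R Q Z) ∧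
    (∀ (Q : Matrix (Fin n) (Fin n) ℝ) (R : Matrix (Fin m) (Fin m) ℝ), Q.PosDef → R.PosDef →
      ∀ Z : Matrix (Fin n) (Fin n) ℝ, Z.PosDef → S.DDARE R Q Z →
        S.IsStabilizedBy μ ω (S.riccatiLaw R Q Z)) := by
  have hlaw : ∀ (Q : Matrix (Fin n) (Fin n) ℝ) (R : Matrix (Fin m) (Fin m) ℝ), Q.PosDef →
      R.PosDef → ∀ Z : Matrix (Fin n) (Fin n) ℝ, Z.PosDef → S.DDARE R Q Z →
        S.IsStabilizedBy μ ω (S.riccatiLaw R Q Z) := by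
    intro Q R hQ hR Z hZ hric
    obtain ⟨K₀, K, h, hv⟩ := S.exists_riccatiLaw_eq_linearLaw (R := R) (Q := Q) (Z := Z) hA
    rw [h, S.isStabilizedBy_linearLaw_iff hω, hv]
    exact S.isMeanSquareStable_riccatiInput hA hR hQ hZ.posSemidef hric
  refine ⟨⟨?_, fun h => ?_⟩, hlaw⟩
  · rintro ⟨law, hst⟩ Q R hQ hR
    obtain ⟨K₀, K, rfl⟩ := hst.1
    exact S.existsUnique_DDARE hA hR hQ ((S.isStabilizedBy_linearLaw_iff hω).1 hst)
  · obtain ⟨Z, ⟨hZ, hric⟩, -⟩ := h 1 1 Matrix.PosDef.one Matrix.PosDef.one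
    exact ⟨_, hlaw 1 1 Matrix.PosDef.one Matrix.PosDef.one Z hZ hric⟩
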